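/- Let $(M,d)$ be an infinite metric space. A transportation problem on $M$ is a finitely supported function $f:M\to\mathbb{R}$ with $\sum_{v\in M}f(v)=0$; its transportation cost norm $\|f\|_{\mathrm{tc}}$ is the infimum of $\sum_{j=1}^m a_j\,d(u_j,v_j)$ over all representations $f=\sum_{j=1}^m a_j(\mathbf{1}_{u_j}-\mathbf{1}_{v_j})$ with $m\ge 0$, $a_j\ge 0$ and $u_j,v_j\in M$. The transportation cost (Lipschitz-free) space $\mathrm{tc}(M)$ is the completion of the real normed space of all transportation problems under $\|\cdot\|_{\mathrm{tc}}$. For a finite set $V\subset M$, a perfect matching of $V$ is a set of edges, each joining two distinct points of $V$, such that every point of $V$ is an end of exactly one of the edges; its weight is the sum of the distances between the ends of its edges. Theorem. There is a linear isometric embedding of the real space $\ell_1=\ell_1(\mathbb{N})$ into $\mathrm{tc}(M)$ if and only if there are sequences $(x_i)_{i\ge 1}$ and $(y_i)_{i\ge 1}$ in $M$, such that all the points $x_1,y_1,x_2,y_2,\dots$ are distinct and, for every $n$, the set of edges $\{x_iy_i\}_{i=1}^n$ has minimum weight among all perfect matchings of the set $\{x_1,y_1,\dots,x_n,y_n\}$.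 -/

import Mathlib

noncomputable section

namespace TransportationCost

/-! ### The transportation cost space of a metric space -/

/-- Transportation problems on `M`: finitely supported real functions on `M` whose values sum to
zero. -/
def TP (M : Type*) : Type _ :=
  ↥(LinearMap.ker (Finsupp.linearCombination ℝ (fun _ : M => (1 : ℝ))))

instance (M : Type*) : AddCommGroup (TP M) :=
  inferInstanceAs (AddCommGroup
    ↥(LinearMap.ker (Finsupp.linearCombination ℝ (fun _ : M => (1 : ℝ)))))

instance (M : Type*) : Module ℝ (TP M) :=
  inferInstanceAs (Module ℝ
    ↥(LinearMap.ker (Finsupp.linearCombination ℝ (fun _ : M => (1 : ℝ)))))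

/-- The inclusion of transportation problems into all finitely supported functions. -/
def TP.toFinsupp (M : Type*) : TP M →ₗ[ℝ] (M →₀ ℝ) :=
  Submodule.subtype (LinearMap.ker (Finsupp.linearCombination ℝ (fun _ : M => (1 : ℝ))))

/-- `transported p = ∑ p (x, y) • (1_x - 1_y)`, the sum running over all pairs `(x, y)`. -/
def transported (M : Type*) : (M × M →₀ ℝ) →ₗ[ℝ] (M →₀ ℝ) :=
  Finsupp.linearCombination ℝ
    (fun e : M × M => Finsupp.single e.1 (1 : ℝ) - Finsupp.single e.2 (1 : ℝ))

/-- The cost `∑ p (x, y) * d (x, y)`, the sum running over all pairs `(x, y)`. -/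
def cost (M : Type*) [MetricSpace M] : (M × M →₀ ℝ) →ₗ[ℝ] ℝ :=
  Finsupp.linearCombination ℝ (fun e : M × M => dist e.1 e.2)

/-- `p` is a transportation plan for `f`: it moves `p (x, y) ≥ 0` units from `x` to `y`, and
`f = ∑ p (x, y) • (1_x - 1_y)`. -/
def IsPlan {M : Type*} (f : TP M) (p : M × M →₀ ℝ) : Prop :=
  (∀ e, 0 ≤ p e) ∧ transported M p = TP.toFinsupp M f

/-- The transportation cost norm: the infimum of the costs of all transportation plans. -/
def tcNorm {M : Type*} [MetricSpace M] (f : TP M) : ℝ :=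
  sInf {c : ℝ | ∃ p : M × M →₀ ℝ, IsPlan f p ∧ c = cost M p}

section NormProperties

variable {M : Type*}

theorem TP.toFinsupp_injective : Function.Injective (TP.toFinsupp M) :=
  Submodule.subtype_injective _

theorem TP.sum_eq_zero (f : TP M) : (TP.toFinsupp M f).sum (fun _ a => a) = 0 := by
  have h : Finsupp.linearCombination ℝ (fun _ : M => (1 : ℝ)) (TP.toFinsupp M f) = 0 := f.2
  simpa [Finsupp.linearCombination_apply] using h

theorem exists_isPlan (f : TP M) : ∃ p, IsPlan f p := by
  classical
  rcases isEmpty_or_nonempty M with hM | ⟨⟨o⟩⟩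
  · exact ⟨0, by simp, Subsingleton.elim _ _⟩
  · set g := TP.toFinsupp M f with hg
    refine ⟨∑ v ∈ g.support, (Finsupp.single (v, o) (max (g v) 0)
      + Finsupp.single (o, v) (max (-g v) 0)), ?_, ?_⟩
    · intro e
      rw [Finsupp.finsetSum_apply]
      refine Finset.sum_nonneg fun v _ => ?_
      rw [Finsupp.add_apply, Finsupp.single_apply, Finsupp.single_apply]
      split_ifs <;> positivity
    · have key : ∀ v, transported M (Finsupp.single (v, o) (max (g v) 0)
          + Finsupp.single (o, v) (max (-g v) 0))
          = Finsupp.single v (g v) - Finsupp.single o (g v) := by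
        intro v
        have hv : g v = max (g v) 0 - max (-g v) 0 := by
          rcases le_total 0 (g v) with h | h <;> simp [h]
        simp only [transported, map_add, Finsupp.linearCombination_single]
        conv_rhs => rw [hv]
        simp only [smul_sub, Finsupp.smul_single, smul_eq_mul, mul_one, Finsupp.single_sub]
        abel
      rw [map_sum, Finset.sum_congr rfl fun v _ => key v, Finset.sum_sub_distrib,
        ← Finsupp.single_finsetSum]
      have h0 : ∑ v ∈ g.support, g v = 0 := TP.sum_eq_zero f
      rw [h0, Finsupp.single_zero, sub_zero]
      exact Finsupp.sum_single g

variable [MetricSpace M]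

theorem cost_nonneg {p : M × M →₀ ℝ} (hp : ∀ e, 0 ≤ p e) : 0 ≤ cost M p := by
  rw [cost, Finsupp.linearCombination_apply]
  exact Finset.sum_nonneg fun e _ => smul_nonneg (hp e) dist_nonneg

theorem tcNorm_le {f : TP M} {p : M × M →₀ ℝ} (h : IsPlan f p) : tcNorm f ≤ cost M p := by
  refine csInf_le ⟨0, ?_⟩ ⟨p, h, rfl⟩
  rintro c ⟨q, hq, rfl⟩
  exact cost_nonneg hq.1

theorem le_tcNorm {f : TP M} {b : ℝ} (h : ∀ p, IsPlan f p → b ≤ cost M p) : b ≤ tcNorm f := by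
  obtain ⟨p, hp⟩ := exists_isPlan f
  refine le_csInf ⟨_, p, hp, rfl⟩ ?_
  rintro c ⟨q, hq, rfl⟩
  exact h q hq

theorem tcNorm_zero : tcNorm (0 : TP M) = 0 :=
  le_antisymm (by simpa using tcNorm_le (f := (0 : TP M)) (p := 0) ⟨by simp, by simp⟩)
    (le_tcNorm fun _ hp => cost_nonneg hp.1)

theorem tcNorm_add_le (f g : TP M) : tcNorm (f + g) ≤ tcNorm f + tcNorm g := by
  rw [← sub_le_iff_le_add]
  refine le_tcNorm fun q hq => ?_
  rw [sub_le_comm]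
  refine le_tcNorm fun p hp => ?_
  rw [sub_le_iff_le_add, ← map_add]
  exact tcNorm_le ⟨fun e => add_nonneg (hp.1 e) (hq.1 e), by
    rw [map_add, map_add, hp.2, hq.2, add_comm]⟩

theorem tcNorm_neg_le (f : TP M) : tcNorm (-f) ≤ tcNorm f := by
  refine le_tcNorm fun p hp => ?_
  have hc : cost M (Finsupp.lmapDomain ℝ ℝ Prod.swap p) = cost M p := by
    rw [cost, Finsupp.lmapDomain_apply, Finsupp.linearCombination_mapDomain]
    congr 1
    congr 1
    funext e
    exact dist_comm _ _
  rw [← hc]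
  refine tcNorm_le ⟨fun e => ?_, ?_⟩
  · have : Finsupp.lmapDomain ℝ ℝ Prod.swap p e = p e.swap := by
      rw [Finsupp.lmapDomain_apply, ← Prod.swap_swap e,
        Finsupp.mapDomain_apply Prod.swap_injective, Prod.swap_swap]
    rw [this]
    exact hp.1 _
  · rw [map_neg, ← hp.2, transported, Finsupp.lmapDomain_apply,
      Finsupp.linearCombination_mapDomain, Finsupp.linearCombination_apply,
      Finsupp.linearCombination_apply, ← Finsupp.sum_neg]
    refine Finsupp.sum_congr fun e _ => ?_
    simp [smul_sub]

theorem tcNorm_neg (f : TP M) : tcNorm (-f) = tcNorm f :=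
  le_antisymm (tcNorm_neg_le f) (by simpa using tcNorm_neg_le (-f))

theorem tcNorm_smul_le_of_nonneg {r : ℝ} (hr : 0 ≤ r) (f : TP M) :
    tcNorm (r • f) ≤ r * tcNorm f := by
  rcases hr.eq_or_lt with rfl | hr'
  · simp [tcNorm_zero]
  · rw [← div_le_iff₀' hr']
    refine le_tcNorm fun p hp => ?_
    rw [div_le_iff₀' hr', ← smul_eq_mul, ← map_smul]
    exact tcNorm_le ⟨fun e => mul_nonneg hr (hp.1 e), by rw [map_smul, map_smul, hp.2]⟩

theorem tcNorm_smul_le (r : ℝ) (f : TP M) : tcNorm (r • f) ≤ |r| * tcNorm f := by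
  rcases le_total 0 r with h | h
  · rw [abs_of_nonneg h]
    exact tcNorm_smul_le_of_nonneg h f
  · rw [abs_of_nonpos h, ← tcNorm_neg, ← neg_smul]
    exact tcNorm_smul_le_of_nonneg (neg_nonneg.2 h) f

theorem eq_zero_of_tcNorm_eq_zero (f : TP M) (hf : tcNorm f = 0) : f = 0 := by
  classical
  -- pairing with a 1-Lipschitz function bounds the norm from below
  have pair : ∀ (f : TP M) (φ : M → ℝ), (∀ x y, φ x - φ y ≤ dist x y) →
      Finsupp.linearCombination ℝ φ (TP.toFinsupp M f) ≤ tcNorm f := by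
    intro f φ hφ
    refine le_tcNorm fun p hp => ?_
    rw [← hp.2, transported, cost, Finsupp.linearCombination_apply ℝ p,
      Finsupp.linearCombination_apply ℝ p, map_finsuppSum]
    refine Finset.sum_le_sum fun e _ => ?_
    simp only [map_smul, map_sub, Finsupp.linearCombination_single, one_smul]
    exact smul_le_smul_of_nonneg_left (hφ _ _) (hp.1 e)
  apply TP.toFinsupp_injective
  rw [map_zero]
  by_contra hne
  set g := TP.toFinsupp M f with hg
  obtain ⟨v, hv⟩ := Finsupp.ne_iff.1 hne
  rw [Finsupp.coe_zero, Pi.zero_apply] at hv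
  obtain ⟨δ, hδ, hsep⟩ : ∃ δ > 0, ∀ u ∈ g.support, u ≠ v → δ ≤ dist v u := by
    have hfin : (↑(g.support.erase v) : Set M).Finite := Finset.finite_toSet _
    have hmem : (↑(g.support.erase v) : Set M)ᶜ ∈ nhds v :=
      hfin.isClosed.isOpen_compl.mem_nhds (by simp)
    obtain ⟨δ, hδ, hb⟩ := Metric.mem_nhds_iff.1 hmem
    refine ⟨δ, hδ, fun u hu huv => ?_⟩
    by_contra hlt
    have : u ∈ Metric.ball v δ := by
      rw [Metric.mem_ball, dist_comm]
      exact not_le.1 hlt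
    exact hb this (by simp [huv, Finsupp.mem_support_iff.1 hu])
  let φ : M → ℝ := fun x => max 0 (δ - dist v x)
  have hφ : ∀ x y, φ x - φ y ≤ dist x y := by
    intro x y
    have h1 : dist v y ≤ dist v x + dist x y := dist_triangle _ _ _
    have h2 : φ x ≤ dist x y + φ y := by
      refine max_le (add_nonneg dist_nonneg (le_max_left _ _)) ?_
      have h3 : δ - dist v y ≤ φ y := le_max_right _ _
      linarith
    linarith
  have hval : Finsupp.linearCombination ℝ φ g = g v * δ := by
    rw [Finsupp.linearCombination_apply, Finsupp.sum,
      Finset.sum_eq_single_of_mem v (Finsupp.mem_support_iff.2 hv)]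
    · simp [φ, hδ.le]
    · intro u hu huv
      have : φ u = 0 := max_eq_left (by linarith [hsep u hu huv])
      rw [this, smul_zero]
  have h1 := pair f φ hφ
  have h2 := pair (-f) φ hφ
  rw [tcNorm_neg, map_neg, map_neg] at h2
  rw [← hg, hval, hf] at h1 h2
  have : g v * δ = 0 := by linarith
  rcases mul_eq_zero.1 this with h | h
  · exact hv h
  · exact hδ.ne' h

end NormProperties

instance (M : Type*) [MetricSpace M] : NormedAddCommGroup (TP M) :=
  AddGroupNorm.toNormedAddCommGroup
    { toFun := tcNorm
      map_zero' := tcNorm_zero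
      add_le' := tcNorm_add_le
      neg' := tcNorm_neg
      eq_zero_of_map_eq_zero' := eq_zero_of_tcNorm_eq_zero }

instance (M : Type*) [MetricSpace M] : NormedSpace ℝ (TP M) where
  norm_smul_le := tcNorm_smul_le

/-- The transportation cost space: the completion of the space of transportation problems under
the transportation cost norm. -/
abbrev TC (M : Type*) [MetricSpace M] : Type _ :=
  UniformSpace.Completion (TP M)

/-! ### Minimum weight perfect matchings -/

/-- The set `E` of edges is a perfect matching of the complete graph on the finite set `V`: its
edges join distinct points of `V`, and each point of `V` is an end of exactly one edge of `E`. -/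
def IsPerfectMatching {M : Type*} (V : Finset M) (E : Finset (Sym2 M)) : Prop :=
  (∀ e ∈ E, ¬ e.IsDiag ∧ ∀ v ∈ e, v ∈ V) ∧ ∀ v ∈ V, ∃! e, e ∈ E ∧ v ∈ e

/-- The length of an edge: the distance between its ends. -/
def edgeLength {M : Type*} [MetricSpace M] : Sym2 M → ℝ :=
  Sym2.lift ⟨fun x y => dist x y, dist_comm⟩

/-- The weight of a finite set of edges. -/
def weight {M : Type*} [MetricSpace M] (E : Finset (Sym2 M)) : ℝ :=
  ∑ e ∈ E, edgeLength e

/-- `E` is a perfect matching of `V` whose weight is minimal among all perfect matchings. -/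
def IsMinWeightPerfectMatching {M : Type*} [MetricSpace M]
    (V : Finset M) (E : Finset (Sym2 M)) : Prop :=
  IsPerfectMatching V E ∧ ∀ E', IsPerfectMatching V E' → weight E ≤ weight E'

open Classical in
/-- The points `x i, y i` with `i < n`. -/
def points {M : Type*} (x y : ℕ → M) (n : ℕ) : Finset M :=
  (Finset.range n).image x ∪ (Finset.range n).image y

open Classical in
/-- The edges joining `x i` to `y i` with `i < n`. -/
def edges {M : Type*} (x y : ℕ → M) (n : ℕ) : Finset (Sym2 M) :=
  (Finset.range n).image (fun i => s(x i, y i))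

end TransportationCost

end

/-! Functionals of norm at most 1 on `TC M` are the 1-Lipschitz functions, acting by integration
(`exists_functional`, `exists_lipschitz_of_functional`). Both directions are linear programming
duality read through this.

From a matching sequence to `ℓ_1`: minimality of a matching means that the costs `d(x_i,y_j) -
d(x_i,y_i)` have no negative cycle, so they have a potential (`exists_potential`), which yields a
1-Lipschitz function saturating every edge. Edges are unordered, so each can be oriented at will
(`IsMatchingSequence.swap`); every choice of signs is thus realised, and the normalised dipoles
satisfy the `ℓ_1` identity.

From `ℓ_1` to a matching sequence: arbitrarily small distances in `M` give a matching sequence by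
geometry alone (`exists_isMatchingSequence_of_not_uniformly_discrete`). If `M` is uniformly
discrete, each nonzero `f` has a pair of points saturated by all functionals norming `f`
(`exists_saturated_pair`). A functional norming `∑ θ_i f_i`, with `f_i` the images of the unit
vectors and `θ_i` signs, norms every `θ_i f_i`, so the saturated pairs realise all signs
simultaneously. Either some point lies in infinitely many pairs, and the other ends form a star in
which all perfect matchings weigh the same, or infinitely many pairs are disjoint, and a
two-colouring argument turns signed Lipschitz functions into dual certificates
(`isMatchingSequence_of_signs`). -/

noncomputable section

namespace TransportationCost

/-! ### Perfect matchings and dual certificates of minimality. -/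

section Matchings

variable {M : Type*}

theorem mem_points {x y : ℕ → M} {n : ℕ} {v : M} :
    v ∈ points x y n ↔ ∃ i < n, v = x i ∨ v = y i := by
  classical
  simp only [points, Finset.mem_union, Finset.mem_image, Finset.mem_range]
  constructor
  · rintro (⟨i, hi, rfl⟩ | ⟨i, hi, rfl⟩)
    · exact ⟨i, hi, Or.inl rfl⟩
    · exact ⟨i, hi, Or.inr rfl⟩
  · rintro ⟨i, hi, rfl | rfl⟩
    · exact Or.inl ⟨i, hi, rfl⟩
    · exact Or.inr ⟨i, hi, rfl⟩

theorem sumElim_injective_iff {x y : ℕ → M} :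
    Function.Injective (Sum.elim x y) ↔
      Function.Injective x ∧ Function.Injective y ∧ ∀ i j, x i ≠ y j :=
  Sum.elim_injective

theorem sum_points {x y : ℕ → M} (h : Function.Injective (Sum.elim x y)) (n : ℕ) (ρ : M → ℝ) :
    ∑ v ∈ points x y n, ρ v = ∑ i ∈ Finset.range n, (ρ (x i) + ρ (y i)) := by
  classical
  obtain ⟨hx, hy, hxy⟩ := sumElim_injective_iff.1 h
  rw [points, Finset.sum_union, Finset.sum_image hx.injOn, Finset.sum_image hy.injOn,
    Finset.sum_add_distrib]
  rw [Finset.disjoint_left]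
  intro v hv hv'
  obtain ⟨i, -, rfl⟩ := Finset.mem_image.1 hv
  obtain ⟨j, -, hj⟩ := Finset.mem_image.1 hv'
  exact hxy i j hj.symm

/-- Matching the points `x i` with the points `y (σ i)` gives a perfect matching. -/
theorem isPerfectMatching_image_perm [DecidableEq (Sym2 M)] {x y : ℕ → M}
    (h : Function.Injective (Sum.elim x y)) (n : ℕ)
    (σ : Equiv.Perm ℕ) (hσ : ∀ i, i ∉ Finset.range n → σ i = i) :
    IsPerfectMatching (points x y n) ((Finset.range n).image fun i => s(x i, y (σ i))) := by
  obtain ⟨hx, hy, hxy⟩ := sumElim_injective_iff.1 h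
  have hlt : ∀ i, i < n ↔ σ i < n := by
    intro i
    constructor
    · intro hi
      by_contra hni
      have := σ.injective (hσ (σ i) (by simpa using hni))
      omega
    · intro hi
      by_contra hni
      have := hσ i (by simpa using hni)
      omega
  refine ⟨?_, ?_⟩
  · intro e he
    obtain ⟨i, hi, rfl⟩ := Finset.mem_image.1 he
    rw [Finset.mem_range] at hi
    refine ⟨by simpa using hxy i _, fun v hv => ?_⟩
    rcases Sym2.mem_iff.1 hv with rfl | rfl
    · exact mem_points.2 ⟨i, hi, Or.inl rfl⟩
    · exact mem_points.2 ⟨σ i, (hlt i).1 hi, Or.inr rfl⟩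
  · intro v hv
    obtain ⟨i, hi, rfl | rfl⟩ := mem_points.1 hv
    · refine ⟨s(x i, y (σ i)), ⟨Finset.mem_image.2 ⟨i, by simpa using hi, rfl⟩, by simp⟩, ?_⟩
      rintro e ⟨he, hve⟩
      obtain ⟨j, hj, rfl⟩ := Finset.mem_image.1 he
      rcases Sym2.mem_iff.1 hve with h1 | h1
      · rw [hx h1]
      · exact absurd h1 (hxy _ _)
    · obtain ⟨k, rfl⟩ := σ.surjective i
      refine ⟨s(x k, y (σ k)), ⟨Finset.mem_image.2 ⟨k, by simpa using (hlt k).2 hi, rfl⟩,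
        by simp⟩, ?_⟩
      rintro e ⟨he, hve⟩
      obtain ⟨j, hj, rfl⟩ := Finset.mem_image.1 he
      rcases Sym2.mem_iff.1 hve with h1 | h1
      · exact absurd h1.symm (hxy _ _)
      · rw [σ.injective (hy h1)]

theorem isPerfectMatching_edges {x y : ℕ → M} (h : Function.Injective (Sum.elim x y)) (n : ℕ) :
    IsPerfectMatching (points x y n) (edges x y n) := by
  classical
  exact isPerfectMatching_image_perm h n 1 fun _ _ => rfl

/-- Double counting. The total does not depend on the matching, which is what makes a potential a
lower bound for all competitors. -/
theorem IsPerfectMatching.sum_lift {V : Finset M} {E : Finset (Sym2 M)}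
    (h : IsPerfectMatching V E) (ρ : M → ℝ) :
    ∑ e ∈ E, Sym2.lift ⟨fun a b => ρ a + ρ b, fun _ _ => add_comm _ _⟩ e = ∑ v ∈ V, ρ v := by
  classical
  have h1 : ∀ e ∈ E, Sym2.lift ⟨fun a b => ρ a + ρ b, fun _ _ => add_comm _ _⟩ e
      = ∑ v ∈ V, if v ∈ e then ρ v else 0 := by
    intro e he
    obtain ⟨hd, hV⟩ := h.1 e he
    induction e with
    | _ a b =>
      have hab : a ≠ b := by simpa using hd
      have : V.filter (· ∈ s(a, b)) = {a, b} := by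
        ext v
        simp only [Finset.mem_filter, Sym2.mem_iff, Finset.mem_insert, Finset.mem_singleton]
        constructor
        · exact fun h => h.2
        · exact fun h => ⟨hV v (Sym2.mem_iff.2 h), h⟩
      rw [← Finset.sum_filter, this, Finset.sum_pair hab, Sym2.lift_mk]
  rw [Finset.sum_congr rfl h1, Finset.sum_comm]
  refine Finset.sum_congr rfl fun v hv => ?_
  obtain ⟨e, he, hu⟩ := h.2 v hv
  rw [Finset.sum_eq_single_of_mem e he.1, if_pos he.2]
  intro e' he' hne
  rw [if_neg]
  exact fun hv' => hne (hu e' ⟨he', hv'⟩)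

/-- The partner map of a perfect matching. -/
theorem IsPerfectMatching.exists_partner {V : Finset M} {E : Finset (Sym2 M)}
    (h : IsPerfectMatching V E) :
    ∃ α : V → V, Function.Involutive α ∧ (∀ v, α v ≠ v) ∧
      ∀ v w : V, s((v : M), (w : M)) ∈ E → w = α v := by
  have h1 : ∀ v : V, ∃ w : V, s((v : M), (w : M)) ∈ E := by
    intro v
    obtain ⟨e, ⟨he, hve⟩, -⟩ := h.2 v v.2
    obtain ⟨w, rfl⟩ := hve
    exact ⟨⟨w, (h.1 _ he).2 w (by simp)⟩, he⟩
  have hu : ∀ v w w' : V, s((v : M), (w : M)) ∈ E → s((v : M), (w' : M)) ∈ E → w = w' := by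
    intro v w w' hw hw'
    have := (h.2 v v.2).unique ⟨hw, by simp⟩ ⟨hw', by simp⟩
    exact Subtype.ext (Sym2.congr_right.1 this)
  choose α hα using h1
  refine ⟨α, fun v => ?_, fun v hv => ?_, fun v w hw => hu v w (α v) hw (hα v)⟩
  · refine hu (α v) _ _ (hα _) ?_
    rw [Sym2.eq_swap]
    exact hα v
  · have := (h.1 _ (hα v)).1
    rw [hv] at this
    simp at this

/-- Two fixed point free involutions have a common alternating two-colouring. -/
theorem exists_alternating_colouring {V : Type*} {α β : V → V} (hα : Function.Involutive α)
    (hβ : Function.Involutive β) (hα' : ∀ v, α v ≠ v) (hβ' : ∀ v, β v ≠ v) :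
    ∃ c : V → Prop, (∀ v, c (α v) ↔ ¬ c v) ∧ ∀ v, c (β v) ↔ ¬ c v := by
  set A : Equiv.Perm V := hα.toPerm with hA
  set B : Equiv.Perm V := hβ.toPerm with hB
  have hAA : A * A = 1 := by ext v; exact hα v
  have hBB : B * B = 1 := by ext v; exact hβ v
  have hAi : A⁻¹ = A := inv_eq_of_mul_eq_one_left hAA
  have hBi : B⁻¹ = B := inv_eq_of_mul_eq_one_left hBB
  set γ : Equiv.Perm V := A * B with hγ
  have hγi : A * γ * A⁻¹ = γ⁻¹ := by
    rw [hγ, mul_inv_rev, hAi, hBi, ← mul_assoc, hAA, one_mul]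
  have hconj : ∀ k : ℤ, A * γ ^ k = γ ^ (-k) * A := by
    intro k
    have : A * γ ^ k * A⁻¹ = (γ⁻¹) ^ k := by rw [← hγi, conj_zpow]
    rw [zpow_neg, ← inv_zpow, ← this, inv_mul_cancel_right]
  -- `A` and `B` generate a dihedral group with rotation `γ`. If `γ ^ k` took `v` to `α v`, then the
  -- point `(γ ^ m) v` halfway along would be fixed by `α` (`k = 2m`) or by `β` (`k = 2m + 1`).
  have hsep : ∀ v, ¬ γ.SameCycle v (α v) := by
    rintro v ⟨k, hk⟩
    have hk' : (γ ^ k) v = A v := hk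
    rcases Int.even_or_odd' k with ⟨m, rfl | rfl⟩
    · apply hα' ((γ ^ m) v)
      have h1 : (A * γ ^ m) v = (γ ^ (-m)) (A v) := by rw [hconj]; rfl
      rw [← hk', ← Equiv.Perm.mul_apply, ← zpow_add] at h1
      rw [show -m + 2 * m = m by ring] at h1
      exact h1
    · apply hβ' ((γ ^ m) v)
      have h1 : (A * γ ^ m) v = (γ ^ (-m)) (A v) := by rw [hconj]; rfl
      rw [← hk', ← Equiv.Perm.mul_apply, ← zpow_add] at h1
      rw [show -m + (2 * m + 1) = 1 + m by ring, zpow_add, zpow_one] at h1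
      have h2 : A ((γ ^ m) v) = A (B ((γ ^ m) v)) := h1
      exact (A.injective h2).symm
  -- Both involutions therefore exchange the same two distinct `γ`-orbits; a well-order on the
  -- orbits decides which of the two gets the colour.
  let q : V → Quotient (Equiv.Perm.SameCycle.setoid γ) := Quotient.mk _
  have hq : ∀ {v w}, q v = q w ↔ γ.SameCycle v w := fun {v w} => Quotient.eq
  have h3 : ∀ v, q (α (β v)) = q v := fun v => (hq.2 ⟨1, by simp [hγ, hA, hB]⟩).symm
  have h4 : ∀ v, q (β v) = q (α v) := by
    intro v
    refine hq.2 ⟨1, ?_⟩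
    simp [hγ, hA, hB, hβ v]
  have hne : ∀ v, q v ≠ q (α v) := fun v h => hsep v (hq.1 h)
  have hflip : ∀ v, WellOrderingRel (q (α v)) (q v) ↔ ¬ WellOrderingRel (q v) (q (α v)) := by
    intro v
    constructor
    · exact fun h h' => asymm h h'
    · intro h
      rcases trichotomous_of WellOrderingRel (q v) (q (α v)) with h' | h' | h'
      · exact absurd h' h
      · exact absurd h' (hne v)
      · exact h'
  refine ⟨fun v => WellOrderingRel (q v) (q (α v)), fun v => ?_, fun v => ?_⟩
  · simpa [hα v] using hflip v
  · simpa [h3, h4] using hflip v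

variable [MetricSpace M]

theorem weight_image_perm [DecidableEq (Sym2 M)] {x y : ℕ → M}
    (h : Function.Injective (Sum.elim x y)) (n : ℕ) (σ : Equiv.Perm ℕ) :
    weight ((Finset.range n).image fun i => s(x i, y (σ i)))
      = ∑ i ∈ Finset.range n, dist (x i) (y (σ i)) := by
  obtain ⟨hx, hy, hxy⟩ := sumElim_injective_iff.1 h
  rw [weight, Finset.sum_image]
  · rfl
  · intro i _ j _ hij
    rcases Sym2.eq_iff.1 hij with h1 | h1
    · exact hx h1.1
    · exact absurd h1.1 (hxy _ _)

theorem weight_edges {x y : ℕ → M} (h : Function.Injective (Sum.elim x y)) (n : ℕ) :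
    weight (edges x y n) = ∑ i ∈ Finset.range n, dist (x i) (y i) := by
  classical
  exact weight_image_perm h n 1

/-- A sequence of pairs of distinct points whose initial segments are minimum weight perfect
matchings. -/
def IsMatchingSequence (x y : ℕ → M) : Prop :=
  Function.Injective (Sum.elim x y) ∧
    ∀ n : ℕ, IsMinWeightPerfectMatching (points x y n) (edges x y n)

/-- A dual certificate of minimality: a potential for each competing matching. -/
theorem isMatchingSequence_of_potential {x y : ℕ → M} (h : Function.Injective (Sum.elim x y))
    (H : ∀ n E, IsPerfectMatching (points x y n) E → ∃ ρ : M → ℝ,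
      (∀ i < n, ρ (x i) + ρ (y i) = dist (x i) (y i)) ∧
      ∀ a b, s(a, b) ∈ E → ρ a + ρ b ≤ dist a b) :
    IsMatchingSequence x y := by
  refine ⟨h, fun n => ⟨isPerfectMatching_edges h n, fun E hE => ?_⟩⟩
  obtain ⟨ρ, h1, h2⟩ := H n E hE
  rw [weight_edges h,
    Finset.sum_congr rfl fun i hi => (h1 i (Finset.mem_range.1 hi)).symm,
    ← sum_points h, ← hE.sum_lift ρ, weight]
  refine Finset.sum_le_sum fun e he => ?_
  induction e with
  | _ a b => exact h2 a b he

/-- Disjoint "balls" around the points, those around `x i` and `y i` being tangent, certify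
minimality. -/
theorem isMatchingSequence_of_radius {x y : ℕ → M} (h : Function.Injective (Sum.elim x y))
    (ρ : M → ℝ) (h1 : ∀ i, ρ (x i) + ρ (y i) = dist (x i) (y i))
    (h2 : ∀ i j, i < j → ρ (x i) + ρ (x j) ≤ dist (x i) (x j) ∧
      ρ (x i) + ρ (y j) ≤ dist (x i) (y j) ∧ ρ (y i) + ρ (x j) ≤ dist (y i) (x j) ∧
      ρ (y i) + ρ (y j) ≤ dist (y i) (y j)) :
    IsMatchingSequence x y := by
  have key : ∀ i j a b, i < j → (a = x i ∨ a = y i) → (b = x j ∨ b = y j) →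
      ρ a + ρ b ≤ dist a b := by
    rintro i j a b hij (rfl | rfl) (rfl | rfl)
    exacts [(h2 i j hij).1, (h2 i j hij).2.1, (h2 i j hij).2.2.1, (h2 i j hij).2.2.2]
  refine isMatchingSequence_of_potential h fun n E hE => ⟨ρ, fun i _ => h1 i, fun a b he => ?_⟩
  obtain ⟨hd, hV⟩ := hE.1 _ he
  have hab : a ≠ b := by simpa using hd
  obtain ⟨i, -, hi⟩ := mem_points.1 (hV a (by simp))
  obtain ⟨j, -, hj⟩ := mem_points.1 (hV b (by simp))
  rcases lt_trichotomy i j with hij | rfl | hij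
  · exact key i j a b hij hi hj
  · rcases hi with rfl | rfl <;> rcases hj with rfl | rfl
    · exact absurd rfl hab
    · exact (h1 i).le
    · rw [add_comm, dist_comm]
      exact (h1 i).le
    · exact absurd rfl hab
  · rw [add_comm, dist_comm]
    exact key j i b a hij hj hi

/-- Pairs whose differences span `ℓ_1` isometrically, all signs being realised by Lipschitz
functions, form a minimum weight matching. -/
theorem isMatchingSequence_of_signs {x y : ℕ → M} (h : Function.Injective (Sum.elim x y))
    (H : ∀ (n : ℕ) (θ : ℕ → ℝ), (∀ i, |θ i| = 1) → ∃ φ : M → ℝ, (∀ a b, φ a - φ b ≤ dist a b) ∧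
      ∀ i < n, φ (x i) - φ (y i) = θ i * dist (x i) (y i)) :
    IsMatchingSequence x y := by
  classical
  obtain ⟨hx, hy, hxy⟩ := sumElim_injective_iff.1 h
  refine isMatchingSequence_of_potential h fun n E hE => ?_
  obtain ⟨α, hα, hα', hαE⟩ := hE.exists_partner
  obtain ⟨β, hβ, hβ', hβE⟩ := (isPerfectMatching_edges h n).exists_partner
  obtain ⟨c, hcα, hcβ⟩ := exists_alternating_colouring hα hβ hα' hβ'
  let s : M → ℝ := fun v => if ∃ hv : v ∈ points x y n, c ⟨v, hv⟩ then 1 else -1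
  have hs : ∀ v, |s v| = 1 := by
    intro v
    simp only [s]
    split_ifs <;> simp
  have hflip : ∀ v w : points x y n, (c w ↔ ¬ c v) → s w = - s v := by
    rintro ⟨v, hv⟩ ⟨w, hw⟩ hcvw
    simp only [s, hv, hw, exists_true_left, hcvw]
    split_ifs <;> simp_all
  obtain ⟨φ, hφ, hφθ⟩ := H n (fun i => s (x i)) fun i => hs _
  -- Edges of both matchings join opposite signs, so `s * φ` sums over an edge to plus or minus the
  -- increment of `φ`: at most the length on `E`, and exactly the length on `x i, y i` by the choice
  -- of `θ`.
  refine ⟨fun v => s v * φ v, fun i hi => ?_, fun a b he => ?_⟩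
  · have hxi : x i ∈ points x y n := mem_points.2 ⟨i, hi, Or.inl rfl⟩
    have hyi : y i ∈ points x y n := mem_points.2 ⟨i, hi, Or.inr rfl⟩
    have h1 : (⟨y i, hyi⟩ : points x y n) = β ⟨x i, hxi⟩ :=
      hβE _ _ (Finset.mem_image.2 ⟨i, by simpa using hi, rfl⟩)
    have h2 : s (y i) = - s (x i) := hflip ⟨x i, hxi⟩ ⟨y i, hyi⟩ (by rw [h1]; exact hcβ _)
    have h3 : s (x i) * s (x i) = 1 := by rw [← abs_mul_abs_self, hs, one_mul]
    change s (x i) * φ (x i) + s (y i) * φ (y i) = _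
    rw [h2]
    linear_combination s (x i) * hφθ i hi + dist (x i) (y i) * h3
  · obtain ⟨-, hV⟩ := hE.1 _ he
    have ha := hV a (by simp)
    have hb := hV b (by simp)
    have h1 : (⟨b, hb⟩ : points x y n) = α ⟨a, ha⟩ := hαE _ _ he
    have h2 : s b = - s a := hflip ⟨a, ha⟩ ⟨b, hb⟩ (by rw [h1]; exact hcα _)
    change s a * φ a + s b * φ b ≤ _
    rw [h2]
    have h3 := hφ a b
    have h4 := hφ b a
    rw [dist_comm] at h4
    rcases (abs_eq zero_le_one).1 (hs a) with h5 | h5 <;> rw [h5] <;> linarith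

end Matchings

/-! ### Potentials for costs without negative cycles. -/

section Potentials

variable {ι : Type*}

/-- The cost of a walk through the vertices of a list. -/
def walkCost (c : ι → ι → ℝ) : List ι → ℝ
  | [] => 0
  | [_] => 0
  | a :: b :: l => c a b + walkCost c (b :: l)

theorem walkCost_append (c : ι → ι → ℝ) (i : ι) (l' : List ι) :
    ∀ l : List ι, walkCost c (l ++ i :: l') = walkCost c (l ++ [i]) + walkCost c (i :: l')
  | [] => by simp [walkCost]
  | [a] => by simp [walkCost]
  | a :: b :: l => by
    have := walkCost_append c i l' (b :: l)
    simp only [List.cons_append, walkCost] at this ⊢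
    linarith

/-- The permutation is the cycle along the list and `z` is the last vertex. Leaving the endpoint `b`
free makes the induction work; `b = a` gives the cost of the closed cycle. -/
theorem exists_perm_of_nodup [DecidableEq ι] (c : ι → ι → ℝ) (l : List ι) :
    ∀ a : ι, (a :: l).Nodup → ∃ (σ : Equiv.Perm ι) (z : ι), z ∈ a :: l ∧
      (∀ i, i ∉ a :: l → σ i = i) ∧ σ z = a ∧
      ∀ b, walkCost c (a :: l ++ [b])
        = ∑ i ∈ (a :: l).toFinset.erase z, c i (σ i) + c z b := by
  induction l with
  | nil => exact fun a _ => ⟨1, a, by simp, by simp, rfl, fun b => by simp [walkCost]⟩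
  | cons a l ih =>
    intro b' hnd
    obtain ⟨hb', hnd'⟩ := List.nodup_cons.1 hnd
    obtain ⟨σ, z, hz, hfix, hza, hsum⟩ := ih a hnd'
    have hzb : z ≠ b' := fun h => hb' (h ▸ hz)
    refine ⟨σ * Equiv.swap b' z, z, List.mem_cons_of_mem _ hz, fun i hi => ?_, ?_, fun b => ?_⟩
    · have h1 : i ≠ b' := fun h => hi (by simp [h])
      have h2 : i ∉ a :: l := fun h => hi (List.mem_cons_of_mem _ h)
      have h3 : i ≠ z := fun h => h2 (h ▸ hz)
      rw [Equiv.Perm.mul_apply, Equiv.swap_apply_of_ne_of_ne h1 h3, hfix i h2]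
    · rw [Equiv.Perm.mul_apply, Equiv.swap_apply_right, hfix b' hb']
    · have h1 : (b' :: a :: l).toFinset.erase z
          = insert b' ((a :: l).toFinset.erase z) := by
        rw [List.toFinset_cons, Finset.erase_insert_of_ne hzb.symm]
      have h2 : b' ∉ (a :: l).toFinset.erase z := by
        intro h
        exact hb' (List.mem_toFinset.1 (Finset.mem_of_mem_erase h))
      rw [h1, Finset.sum_insert h2, Equiv.Perm.mul_apply, Equiv.swap_apply_left, hza, add_assoc]
      have h3 : ∑ i ∈ (a :: l).toFinset.erase z, c i ((σ * Equiv.swap b' z) i)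
          = ∑ i ∈ (a :: l).toFinset.erase z, c i (σ i) := by
        refine Finset.sum_congr rfl fun i hi => ?_
        rw [Equiv.Perm.mul_apply, Equiv.swap_apply_of_ne_of_ne _ (Finset.ne_of_mem_erase hi)]
        rintro rfl
        exact h2 hi
      rw [h3, ← hsum b]
      rfl

/-- Costs without negative cycles have a potential. -/
theorem exists_potential (s : Finset ι) (c : ι → ι → ℝ) (hc : ∀ i, c i i = 0)
    (h : ∀ σ : Equiv.Perm ι, (∀ i, i ∉ s → σ i = i) → 0 ≤ ∑ i ∈ s, c i (σ i)) :
    ∃ v : ι → ℝ, ∀ i ∈ s, ∀ j ∈ s, v i ≤ c i j + v j := by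
  classical
  have hcyc : ∀ a l, (a :: l).Nodup → (∀ i ∈ a :: l, i ∈ s) → 0 ≤ walkCost c (a :: l ++ [a]) := by
    intro a l hnd hl
    obtain ⟨σ, z, hz, hfix, hza, hsum⟩ := exists_perm_of_nodup c l a hnd
    have h1 := h σ fun i hi => hfix i fun hi' => hi (hl i hi')
    have hsub : (a :: l).toFinset ⊆ s := fun i hi => hl i (List.mem_toFinset.1 hi)
    have h2 : ∑ i ∈ (a :: l).toFinset, c i (σ i) = ∑ i ∈ s, c i (σ i) := by
      refine Finset.sum_subset hsub fun i _ hi => ?_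
      rw [hfix i fun h => hi (List.mem_toFinset.2 h), hc]
    rw [hsum a]
    rw [← h2, ← Finset.sum_erase_add _ _ (List.mem_toFinset.2 hz), hza] at h1
    exact h1
  set B : ℝ := ∑ i ∈ s, ∑ j ∈ s, |c i j| with hB
  have hcB : ∀ i ∈ s, ∀ j ∈ s, c i j ≤ B := fun i hi j hj =>
    (le_abs_self _).trans <| (Finset.single_le_sum (f := fun j => |c i j|)
      (fun _ _ => abs_nonneg _) hj).trans <|
      Finset.single_le_sum (f := fun i => ∑ j ∈ s, |c i j|)
        (fun _ _ => Finset.sum_nonneg fun _ _ => abs_nonneg _) hi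
  have hclose : ∀ (l : List ι) (a b : ι), (∀ i ∈ a :: l, i ∈ s) → b ∈ s →
      walkCost c (a :: l ++ [b]) ≤ walkCost c (a :: l) + B := by
    intro l
    induction l with
    | nil =>
      intro a b hl hb
      simpa [walkCost] using hcB a (hl a (by simp)) b hb
    | cons a' l ih =>
      intro a b hl hb
      have := ih a' b (fun i hi => hl i (List.mem_cons_of_mem _ hi)) hb
      simp only [List.cons_append, walkCost] at this ⊢
      linarith
  -- The potential at `i` is the infimum of the costs of simple paths starting at `i` and ending
  -- anywhere in `s`. Closing such a path costs at most `B` more and gives a nonnegative cycle,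
  -- hence the bound `-B`.
  let W : ι → Set ℝ := fun i =>
    {r | ∃ l : List ι, (i :: l).Nodup ∧ (∀ k ∈ i :: l, k ∈ s) ∧ r = walkCost c (i :: l)}
  have hbdd : ∀ i, BddBelow (W i) := by
    intro i
    refine ⟨-B, ?_⟩
    rintro r ⟨l, hnd, hl, rfl⟩
    have h1 := hclose l i i hl (hl i (by simp))
    have h2 := hcyc i l hnd hl
    linarith
  refine ⟨fun i => sInf (W i), fun i hi j hj => ?_⟩
  rw [← sub_le_iff_le_add']
  refine le_csInf ⟨_, [], by simp, by simpa using hj, rfl⟩ ?_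
  rintro r ⟨l, hnd, hl, rfl⟩
  rw [sub_le_iff_le_add']
  -- If prefixing `i` destroys simplicity, the cycle through `i` is cut off; its cost is
  -- nonnegative, so the remaining path from `i` is no dearer.
  by_cases hmem : i ∈ j :: l
  · obtain ⟨l₁, l₂, hsplit⟩ := List.append_of_mem hmem
    have h1 : walkCost c (i :: j :: l) = c i j + walkCost c (j :: l) := rfl
    have h2 : walkCost c (i :: j :: l)
        = walkCost c (i :: l₁ ++ [i]) + walkCost c (i :: l₂) := by
      rw [hsplit, ← List.cons_append, walkCost_append]
    rw [hsplit] at hnd hl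
    have h3 : (i :: l₁).Nodup := by
      have := List.nodup_middle.1 hnd
      rw [← List.cons_append] at this
      exact this.of_append_left
    have h4 := hcyc i l₁ h3 fun k hk => hl k (by
      rcases List.mem_cons.1 hk with rfl | hk <;> simp [*])
    have h5 : sInf (W i) ≤ walkCost c (i :: l₂) :=
      csInf_le (hbdd i) ⟨l₂, hnd.of_append_right, fun k hk => hl k (List.mem_append_right _ hk),
        rfl⟩
    linarith
  · refine csInf_le (hbdd i) ⟨j :: l, List.nodup_cons.2 ⟨hmem, hnd⟩, fun k hk => ?_, rfl⟩
    rcases List.mem_cons.1 hk with rfl | hk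
    · exact hi
    · exact hl k hk

end Potentials

/-! ### From minimum weight matchings to Lipschitz functions. -/

section Duality

variable {M : Type*} [MetricSpace M]

/-- A minimum weight matching is saturated by a Lipschitz function. -/
theorem IsMatchingSequence.exists_lipschitz {x y : ℕ → M} (h : IsMatchingSequence x y) (n : ℕ) :
    ∃ φ : M → ℝ, (∀ a b, φ a - φ b ≤ dist a b) ∧
      ∀ i < n, φ (x i) - φ (y i) = dist (x i) (y i) := by
  classical
  obtain ⟨hinj, hmin⟩ := h
  -- Along a permutation these costs add up to the weight of the rematched edges minus that of the
  -- given ones.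
  obtain ⟨v, hv⟩ := exists_potential (Finset.range n)
    (fun i j => dist (x i) (y j) - dist (x i) (y i)) (fun i => sub_self _) fun σ hσ => by
      have := (hmin n).2 _ (isPerfectMatching_image_perm hinj n σ hσ)
      rw [weight_edges hinj, weight_image_perm hinj] at this
      rw [Finset.sum_sub_distrib]
      linarith
  rcases Nat.eq_zero_or_pos n with rfl | hn
  · exact ⟨0, fun a b => by simp, fun i hi => absurd hi (Nat.not_lt_zero i)⟩
  have hne : (Finset.range n).Nonempty := ⟨0, Finset.mem_range.2 hn⟩
  -- A McShane-type formula: `φ (y i) ≤ v i` by taking `j = i`, while the potential inequality says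
  -- exactly that `φ (x i) ≥ v i + dist (x i) (y i)`.
  let φ : M → ℝ := fun z => (Finset.range n).inf' hne fun j => v j + dist z (y j)
  have hφ : ∀ a b, φ a - φ b ≤ dist a b := by
    intro a b
    rw [sub_le_comm]
    refine Finset.le_inf' _ _ fun j hj => ?_
    have h1 : φ a ≤ v j + dist a (y j) := Finset.inf'_le _ hj
    have h2 := dist_triangle a b (y j)
    linarith
  refine ⟨φ, hφ, fun i hi => le_antisymm (hφ _ _) ?_⟩
  have hi' := Finset.mem_range.2 hi
  have h1 : φ (y i) ≤ v i + dist (y i) (y i) := Finset.inf'_le _ hi'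
  have h2 : v i + dist (x i) (y i) ≤ φ (x i) := by
    refine Finset.le_inf' _ _ fun j hj => ?_
    linarith [hv i hi' j hj]
  rw [dist_self] at h1
  linarith

/-- Vertex set and unordered edges do not see orientation. This is the source of arbitrary signs. -/
theorem IsMatchingSequence.swap {x y : ℕ → M} (h : IsMatchingSequence x y) (p : ℕ → Prop)
    [DecidablePred p] :
    IsMatchingSequence (fun i => if p i then x i else y i) (fun i => if p i then y i else x i) := by
  classical
  obtain ⟨hinj, hmin⟩ := h
  obtain ⟨hx, hy, hxy⟩ := sumElim_injective_iff.1 hinj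
  refine ⟨sumElim_injective_iff.2 ⟨fun i j hij => ?_, fun i j hij => ?_, fun i j hij => ?_⟩,
    fun n => ?_⟩
  · dsimp only at hij
    split_ifs at hij
    exacts [hx hij, absurd hij (hxy _ _), absurd hij.symm (hxy _ _), hy hij]
  · dsimp only at hij
    split_ifs at hij
    exacts [hy hij, absurd hij.symm (hxy _ _), absurd hij (hxy _ _), hx hij]
  · change (if p i then x i else y i) = (if p j then y j else x j) at hij
    split_ifs at hij with h1 h2 h2
    · exact hxy _ _ hij
    · exact h2 (hx hij ▸ h1)
    · exact h1 (hy hij ▸ h2)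
    · exact hxy _ _ hij.symm
  · have h1 : points (fun i => if p i then x i else y i) (fun i => if p i then y i else x i) n
        = points x y n := by
      ext v
      simp only [mem_points]
      refine exists_congr fun i => and_congr_right fun _ => ?_
      split_ifs
      · rfl
      · exact or_comm
    have h2 : edges (fun i => if p i then x i else y i) (fun i => if p i then y i else x i) n
        = edges x y n := by
      refine Finset.image_congr fun i _ => ?_
      dsimp only
      split_ifs
      · rfl
      · exact Sym2.eq_swap
    rw [h1, h2]
    exact hmin n

end Duality

/-! ### Duality between `TC M` and Lipschitz functions. -/

section Functionals

variable {M : Type*}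

/-- The transportation problem `1_x - 1_y`. -/
def dipole (x y : M) : TP M :=
  ⟨Finsupp.single x 1 - Finsupp.single y 1, by simp⟩

theorem toFinsupp_dipole (x y : M) :
    TP.toFinsupp M (dipole x y) = Finsupp.single x 1 - Finsupp.single y 1 := rfl

/-- Integration of a function against transportation problems. -/
def pairing (φ : M → ℝ) : TP M →ₗ[ℝ] ℝ :=
  Finsupp.linearCombination ℝ φ ∘ₗ TP.toFinsupp M

theorem pairing_apply (φ : M → ℝ) (f : TP M) :
    pairing φ f = ∑ x ∈ (TP.toFinsupp M f).support, TP.toFinsupp M f x * φ x := by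
  simp [pairing, Finsupp.linearCombination_apply, Finsupp.sum]

theorem pairing_dipole (φ : M → ℝ) (x y : M) : pairing φ (dipole x y) = φ x - φ y := by
  simp [pairing, toFinsupp_dipole]

theorem pairing_add_left (φ ψ : M → ℝ) (f : TP M) :
    pairing (fun x => φ x + ψ x) f = pairing φ f + pairing ψ f := by
  simp only [pairing_apply, mul_add, Finset.sum_add_distrib]

theorem pairing_const (r : ℝ) (f : TP M) : pairing (fun _ => r) f = 0 := by
  rw [pairing_apply, ← Finset.sum_mul]
  have : ∑ x ∈ (TP.toFinsupp M f).support, TP.toFinsupp M f x = 0 := TP.sum_eq_zero f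
  rw [this, zero_mul]

variable [MetricSpace M]

theorem TP.norm_def (f : TP M) : ‖f‖ = tcNorm f := rfl

theorem pairing_le {φ : M → ℝ} {K : ℝ} (hK : 0 ≤ K) (hφ : ∀ x y, φ x - φ y ≤ K * dist x y) (f : TP M) :
    pairing φ f ≤ K * ‖f‖ := by
  have hcost : ∀ p, IsPlan f p → pairing φ f ≤ K * cost M p := by
    intro p hp
    rw [pairing, LinearMap.comp_apply, ← hp.2, transported, cost,
      Finsupp.linearCombination_apply ℝ p, Finsupp.linearCombination_apply ℝ p, map_finsuppSum,
      Finsupp.sum, Finsupp.sum, Finset.mul_sum]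
    refine Finset.sum_le_sum fun e _ => ?_
    simp only [map_smul, map_sub, Finsupp.linearCombination_single, smul_eq_mul]
    nlinarith [mul_le_mul_of_nonneg_left (hφ e.1 e.2) (hp.1 e)]
  rcases hK.eq_or_lt with rfl | hK
  · obtain ⟨p, hp⟩ := exists_isPlan f
    simpa using hcost p hp
  · rw [← div_le_iff₀' hK]
    exact le_tcNorm fun p hp => (div_le_iff₀' hK).2 (hcost p hp)

theorem norm_dipole_le (x y : M) : ‖dipole x y‖ ≤ dist x y := by
  have h : IsPlan (dipole x y) (Finsupp.single (x, y) 1) := by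
    classical
    refine ⟨fun e => ?_, by simp [transported, toFinsupp_dipole]⟩
    rw [Finsupp.single_apply]
    split_ifs <;> norm_num
  rw [TP.norm_def]
  simpa [cost] using tcNorm_le h

/-- A Lipschitz function extends to a functional on the transportation cost space. -/
theorem exists_functional {φ : M → ℝ} {K : ℝ} (hK : 0 ≤ K)
    (hφ : ∀ x y, φ x - φ y ≤ K * dist x y) :
    ∃ Λ : TC M →L[ℝ] ℝ, ‖Λ‖ ≤ K ∧ ∀ g : TP M, Λ g = pairing φ g := by
  have hb : ∀ g : TP M, ‖pairing φ g‖ ≤ K * ‖g‖ := by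
    intro g
    have h1 := pairing_le hK hφ g
    have h2 := pairing_le hK hφ (-g)
    rw [map_neg, norm_neg] at h2
    exact abs_le.2 ⟨by linarith, h1⟩
  let L : TP M →L[ℝ] ℝ := (pairing φ).mkContinuous K hb
  have hd : DenseRange (UniformSpace.Completion.toComplL : TP M →L[ℝ] TC M) :=
    UniformSpace.Completion.denseRange_coe
  refine ⟨L.extend UniformSpace.Completion.toComplL, ?_, fun g => ?_⟩
  · refine (L.opNorm_extend_le (N := 1) hd fun g => ?_).trans ?_
    · simp
    · rw [NNReal.coe_one, one_mul]
      exact LinearMap.mkContinuous_norm_le _ hK hb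
  · exact L.extend_eq hd (UniformSpace.Completion.isUniformInducing_coe _) g

/-- The Lipschitz function of a functional on the transportation cost space. -/
theorem exists_lipschitz_of_functional [Nonempty M] (Λ : TC M →L[ℝ] ℝ) (hΛ : ‖Λ‖ ≤ 1) :
    ∃ φ : M → ℝ, (∀ x y, φ x - φ y ≤ dist x y) ∧ ∀ g : TP M, Λ g = pairing φ g := by
  classical
  obtain ⟨o⟩ := ‹Nonempty M›
  let L : TP M →ₗ[ℝ] ℝ := Λ.toLinearMap ∘ₗ
    (UniformSpace.Completion.toComplL : TP M →L[ℝ] TC M).toLinearMap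
  have hL : ∀ g : TP M, Λ g = L g := fun g => rfl
  have hrep : ∀ g : TP M, L g = pairing (fun x => L (dipole x o)) g := by
    intro g
    -- Sending everything through the base point `o` is harmless because the total mass is zero.
    have hg : g = ∑ x ∈ (TP.toFinsupp M g).support, TP.toFinsupp M g x • dipole x o := by
      apply TP.toFinsupp_injective
      rw [map_sum]
      simp only [map_smul, toFinsupp_dipole, smul_sub, Finset.sum_sub_distrib,
        Finsupp.smul_single, smul_eq_mul, mul_one]
      rw [← Finsupp.single_finsetSum]
      have h0 : ∑ x ∈ (TP.toFinsupp M g).support, TP.toFinsupp M g x = 0 := TP.sum_eq_zero g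
      rw [h0, Finsupp.single_zero, sub_zero]
      exact (Finsupp.sum_single _).symm
    rw [pairing_apply]
    conv_lhs => rw [hg]
    simp
  refine ⟨fun x => L (dipole x o), fun x y => ?_, fun g => (hL g).trans (hrep g)⟩
  have h1 := hrep (dipole x y)
  rw [pairing_dipole] at h1
  rw [← h1, ← hL]
  calc Λ (dipole x y) ≤ ‖Λ (dipole x y)‖ := Real.le_norm_self _
    _ ≤ ‖Λ‖ * ‖((dipole x y : TP M) : TC M)‖ := Λ.le_opNorm _
    _ ≤ 1 * ‖((dipole x y : TP M) : TC M)‖ := by gcongr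
    _ ≤ dist x y := by
      rw [one_mul, UniformSpace.Completion.norm_coe]
      exact norm_dipole_le x y

end Functionals

/-! ### Matching sequences span `ℓ_1`. -/

section Embedding

/-- A sequence satisfying the `ℓ_1` identity on finite sums spans a copy of `ℓ_1`. -/
theorem nonempty_linearIsometry_of_norm_sum {E : Type*} [NormedAddCommGroup E] [NormedSpace ℝ E]
    [CompleteSpace E] (b : ℕ → E)
    (hb : ∀ (a : ℕ → ℝ) (n : ℕ), ‖∑ i ∈ Finset.range n, a i • b i‖ = ∑ i ∈ Finset.range n, |a i|) :
    Nonempty (lp (fun _ : ℕ => ℝ) 1 →ₗᵢ[ℝ] E) := by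
  have hb1 : ∀ i, ‖b i‖ ≤ 1 := by
    intro i
    classical
    have := hb (Pi.single i 1) (i + 1)
    rw [Finset.sum_eq_single_of_mem i (by simp) (fun j _ hj => by simp [hj]),
      Finset.sum_eq_single_of_mem i (by simp) (fun j _ hj => by simp [hj])] at this
    simpa using this.le
  have hnorm : ∀ a : lp (fun _ : ℕ => ℝ) 1, HasSum (fun i => |a i|) ‖a‖ := by
    intro a
    simpa using lp.hasSum_norm (p := 1) (by simp) a
  have hs : ∀ a : lp (fun _ : ℕ => ℝ) 1, Summable fun i => a i • b i := by
    intro a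
    refine Summable.of_norm_bounded (hnorm a).summable fun i => ?_
    rw [norm_smul, Real.norm_eq_abs]
    exact mul_le_of_le_one_right (abs_nonneg _) (hb1 i)
  refine ⟨⟨⟨⟨fun a => ∑' i, a i • b i, fun a a' => ?_⟩, fun r a => ?_⟩, fun a => ?_⟩⟩
  · rw [← (hs a).tsum_add (hs a')]
    simp [add_smul]
  · simp only [lp.coeFn_smul, Pi.smul_apply, smul_eq_mul, mul_smul, RingHom.id_apply]
    exact (hs a).tsum_const_smul r
  · have h1 := (hs a).hasSum.tendsto_sum_nat.norm
    simp only [hb] at h1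
    exact tendsto_nhds_unique h1 (hnorm a).tendsto_sum_nat

theorem IsMatchingSequence.nonempty_linearIsometry {M : Type*} [MetricSpace M] {x y : ℕ → M}
    (h : IsMatchingSequence x y) : Nonempty (lp (fun _ : ℕ => ℝ) 1 →ₗᵢ[ℝ] TC M) := by
  classical
  have hd : ∀ i, 0 < dist (x i) (y i) := fun i =>
    dist_pos.2 ((sumElim_injective_iff.1 h.1).2.2 i i)
  let b : ℕ → TC M := fun i => (((dist (x i) (y i))⁻¹ • dipole (x i) (y i) : TP M) : TC M)
  refine nonempty_linearIsometry_of_norm_sum b fun a n => le_antisymm ?_ ?_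
  · refine (norm_sum_le _ _).trans (Finset.sum_le_sum fun i _ => ?_)
    rw [norm_smul, Real.norm_eq_abs]
    refine mul_le_of_le_one_right (abs_nonneg _) ?_
    rw [UniformSpace.Completion.norm_coe, norm_smul, norm_inv, Real.norm_of_nonneg (hd i).le,
      inv_mul_le_one₀ (hd i)]
    exact norm_dipole_le _ _
  -- Orienting edge `i` by the sign of `a i` yields a single functional of norm at most 1 that takes
  -- the value `∑ |a i|`.
  · obtain ⟨φ, hφ, hφd⟩ := (h.swap fun i => 0 ≤ a i).exists_lipschitz n
    obtain ⟨Λ, hΛ, hrep⟩ := exists_functional (φ := φ) zero_le_one (by simpa using hφ)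
    have h1 : ∀ i < n, a i * Λ (b i) = |a i| := by
      intro i hi
      have h2 := hφd i hi
      rw [hrep, map_smul, pairing_dipole, smul_eq_mul]
      have h3 := (hd i).ne'
      rcases le_or_gt 0 (a i) with ha | ha
      · simp only [ha, if_true] at h2
        rw [h2, inv_mul_cancel₀ h3, mul_one, abs_of_nonneg ha]
      · simp only [not_le.2 ha, if_false] at h2
        rw [← neg_sub, h2, dist_comm (y i), mul_neg, inv_mul_cancel₀ h3, abs_of_neg ha]
        ring
    calc ∑ i ∈ Finset.range n, |a i| = Λ (∑ i ∈ Finset.range n, a i • b i) := by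
          rw [map_sum]
          refine Finset.sum_congr rfl fun i hi => ?_
          rw [map_smul, smul_eq_mul, h1 i (Finset.mem_range.1 hi)]
      _ ≤ ‖Λ (∑ i ∈ Finset.range n, a i • b i)‖ := Real.le_norm_self _
      _ ≤ ‖Λ‖ * ‖∑ i ∈ Finset.range n, a i • b i‖ := Λ.le_opNorm _
      _ ≤ 1 * ‖∑ i ∈ Finset.range n, a i • b i‖ := by gcongr
      _ = _ := one_mul _

end Embedding

/-! ### Geometric constructions of matching sequences. -/

section Geometry

open Filter Topology

variable {M : Type*}

theorem sumElim_injective_of_lt {x y : ℕ → M} (h : ∀ i, x i ≠ y i)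
    (h' : ∀ i j, i < j → x i ≠ x j ∧ x i ≠ y j ∧ y i ≠ x j ∧ y i ≠ y j) :
    Function.Injective (Sum.elim x y) := by
  refine sumElim_injective_iff.2 ⟨fun i j hij => ?_, fun i j hij => ?_, fun i j hij => ?_⟩
  · rcases lt_trichotomy i j with hlt | rfl | hlt
    exacts [absurd hij (h' i j hlt).1, rfl, absurd hij.symm (h' j i hlt).1]
  · rcases lt_trichotomy i j with hlt | rfl | hlt
    exacts [absurd hij (h' i j hlt).2.2.2, rfl, absurd hij.symm (h' j i hlt).2.2.2]
  · rcases lt_trichotomy i j with hlt | rfl | hlt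
    exacts [(h' i j hlt).2.1 hij, h i hij, (h' j i hlt).2.2.1 hij.symm]

variable [MetricSpace M]

theorem isMatchingSequence_of_radii {x y : ℕ → M} (h : Function.Injective (Sum.elim x y))
    (α β : ℕ → ℝ) (h1 : ∀ i, α i + β i = dist (x i) (y i))
    (h2 : ∀ i j, i < j → α i + α j ≤ dist (x i) (x j) ∧
      α i + β j ≤ dist (x i) (y j) ∧ β i + α j ≤ dist (y i) (x j) ∧
      β i + β j ≤ dist (y i) (y j)) :
    IsMatchingSequence x y := by
  have hx : ∀ i, Function.extend (Sum.elim x y) (Sum.elim α β) 0 (x i) = α i := fun i =>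
    h.extend_apply (Sum.elim α β) 0 (Sum.inl i)
  have hy : ∀ i, Function.extend (Sum.elim x y) (Sum.elim α β) 0 (y i) = β i := fun i =>
    h.extend_apply (Sum.elim α β) 0 (Sum.inr i)
  refine isMatchingSequence_of_radius h (Function.extend (Sum.elim x y) (Sum.elim α β) 0)
    (fun i => ?_) fun i j hij => ?_
  · rw [hx, hy, h1]
  · simpa only [hx, hy] using h2 i j hij

/-- In an infinite star every perfect matching has the same weight. -/
theorem exists_isMatchingSequence_of_star {z : ℕ → M} (hz : Function.Injective z) (r : ℕ → ℝ)
    (h : ∀ i j, i ≠ j → dist (z i) (z j) = r i + r j) :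
    ∃ x y : ℕ → M, IsMatchingSequence x y := by
  refine ⟨fun i => z (2 * i), fun i => z (2 * i + 1),
    isMatchingSequence_of_radii (sumElim_injective_of_lt ?_ ?_)
      (fun i => r (2 * i)) (fun i => r (2 * i + 1)) ?_ ?_⟩
  · exact fun i => hz.ne (by omega)
  · exact fun i j hij =>
      ⟨hz.ne (by omega), hz.ne (by omega), hz.ne (by omega), hz.ne (by omega)⟩
  · exact fun i => (h _ _ (by omega)).symm
  · exact fun i j hij => ⟨(h _ _ (by omega)).ge, (h _ _ (by omega)).ge, (h _ _ (by omega)).ge,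
      (h _ _ (by omega)).ge⟩

/-- `r` is the distance to an accumulation point of `M`, possibly outside `M`. -/
theorem exists_isMatchingSequence_of_accumulation (r : M → ℝ)
    (h1 : ∀ a b, r a ≤ r b + dist a b) (h2 : ∀ a b, dist a b ≤ r a + r b)
    (h3 : ∀ η > 0, ∃ w, 0 < r w ∧ r w < η) :
    ∃ x y : ℕ → M, IsMatchingSequence x y := by
  -- The excess `r a + r b - dist a b` is twice the Gromov product at the accumulation point. If it
  -- vanishes for all distinct points near (but not at) that point, they form a star; otherwise
  -- pairs with positive excess occur at every scale.
  by_cases hg : ∀ η > 0, ∃ p : M × M, p.1 ≠ p.2 ∧ (0 < r p.1 ∧ r p.1 < η) ∧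
      (0 < r p.2 ∧ r p.2 < η) ∧ 0 < r p.1 + r p.2 - dist p.1 p.2
  · let g : M × M → ℝ := fun p => r p.1 + r p.2 - dist p.1 p.2
    obtain ⟨f, hf, hff⟩ := exists_seq_of_forall_finset_exists
      (fun p : M × M => p.1 ≠ p.2 ∧ 0 < r p.1 ∧ 0 < r p.2 ∧ 0 < g p)
      (fun p q => r q.1 < g p / 4 ∧ r q.2 < g p / 4) (by
        intro s hs
        obtain ⟨η, hη, hηs⟩ : ∃ η > 0, ∀ p ∈ s, η ≤ g p / 4 := by
          have : ∀ᶠ η in 𝓝[>] (0 : ℝ), ∀ p ∈ s, η ≤ g p / 4 := by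
            rw [Filter.eventually_all_finset]
            intro p hp
            exact nhdsWithin_le_nhds (eventually_le_nhds (by linarith [(hs p hp).2.2.2]))
          exact (this.and self_mem_nhdsWithin).exists.imp fun η h => ⟨h.2, h.1⟩
        obtain ⟨p, hp, hp1, hp2, hp3⟩ := hg η hη
        exact ⟨p, ⟨hp, hp1.1, hp2.1, hp3⟩, fun q hq =>
          ⟨hp1.2.trans_le (hηs q hq), hp2.2.trans_le (hηs q hq)⟩⟩)
    have hg1 : ∀ p, g p ≤ 2 * r p.1 := fun p => by
      have := h1 p.2 p.1
      rw [dist_comm] at this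
      simp only [g]
      linarith
    have hg2 : ∀ p, g p ≤ 2 * r p.2 := fun p => by
      have := h1 p.1 p.2
      simp only [g]
      linarith
    -- Each radius is `r` less half the excess of its pair. For `i < j` that half exceeds `2 * r` at
    -- either end of pair `j`, so the radii sum to less than a difference of `r`-values, hence less
    -- than the distance.
    refine ⟨fun i => (f i).1, fun i => (f i).2,
      isMatchingSequence_of_radii (sumElim_injective_of_lt (fun i => (hf i).1) ?_)
      (fun i => r (f i).1 - g (f i) / 2) (fun i => r (f i).2 - g (f i) / 2) ?_ ?_⟩
    · intro i j hij
      have a1 := hff i j hij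
      have a2 := hg1 (f i)
      have a3 := hg2 (f i)
      have a4 := (hf i).2.2.2
      refine ⟨fun h => ?_, fun h => ?_, fun h => ?_, fun h => ?_⟩ <;>
        (have h' := congrArg r h; linarith)
    · intro i
      simp only [g]
      ring
    · intro i j hij
      have a1 := hff i j hij
      have a4 := (hf j).2.2.2
      refine ⟨?_, ?_, ?_, ?_⟩
      · linarith [h1 (f i).1 (f j).1]
      · linarith [h1 (f i).1 (f j).2]
      · linarith [h1 (f i).2 (f j).1]
      · linarith [h1 (f i).2 (f j).2]
  · push Not at hg
    obtain ⟨η, hη, hstar⟩ := hg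
    obtain ⟨z, hz, hzz⟩ := exists_seq_of_forall_finset_exists
      (fun w : M => 0 < r w ∧ r w < η) (fun w w' => r w' < r w) (by
        intro s hs
        obtain ⟨η', hη', hηs⟩ : ∃ η' > 0, η' ≤ η ∧ ∀ p ∈ s, η' ≤ r p := by
          have h4 : ∀ᶠ η' in 𝓝[>] (0 : ℝ), ∀ p ∈ s, η' ≤ r p := by
            rw [Filter.eventually_all_finset]
            intro p hp
            exact nhdsWithin_le_nhds (eventually_le_nhds (hs p hp).1)
          have h5 : ∀ᶠ η' in 𝓝[>] (0 : ℝ), η' ≤ η := nhdsWithin_le_nhds (eventually_le_nhds hη)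
          exact ((h5.and h4).and self_mem_nhdsWithin).exists.imp fun η h => ⟨h.2, h.1⟩
        obtain ⟨w, hw, hw'⟩ := h3 η' hη'
        exact ⟨w, ⟨hw, hw'.trans_le hηs.1⟩, fun p hp => hw'.trans_le (hηs.2 p hp)⟩)
    have hinj : Function.Injective z := by
      intro i j hij
      rcases lt_trichotomy i j with hlt | rfl | hlt
      · exact absurd (hzz i j hlt) (by rw [hij]; exact lt_irrefl _)
      · rfl
      · exact absurd (hzz j i hlt) (by rw [hij]; exact lt_irrefl _)
    refine exists_isMatchingSequence_of_star hinj (fun i => r (z i)) fun i j hij => ?_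
    refine le_antisymm (h2 _ _) ?_
    have := hstar (z i, z j) (hinj.ne hij) (hz i) (hz j)
    simp only at this
    linarith

/-- A space with arbitrarily small distances has a matching sequence. -/
theorem exists_isMatchingSequence_of_not_uniformly_discrete
    (h : ∀ δ > 0, ∃ u v : M, u ≠ v ∧ dist u v < δ) :
    ∃ x y : ℕ → M, IsMatchingSequence x y := by
  choose u v huv hd using fun k : ℕ => h (1 / ((k : ℝ) + 1)) Nat.one_div_pos_of_nat
  have hlim : ∀ η > 0, ∀ᶠ k in (hyperfilter ℕ : Filter ℕ), dist (u k) (v k) < η := by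
    intro η hη
    have h1 : Tendsto (fun k : ℕ => 1 / ((k : ℝ) + 1)) (hyperfilter ℕ) (𝓝 0) :=
      tendsto_one_div_add_atTop_nhds_zero_nat.mono_left Nat.hyperfilter_le_atTop
    filter_upwards [h1.eventually_lt_const hη] with k hk
    exact (hd k).trans hk
  -- A Cauchy ultrafilter has a limit in the completion, and at least one of the nearby distinct
  -- points `u k`, `v k` is not that limit. Otherwise no ball of radius `ε / 2` captures the
  -- ultrafilter, so short pairs can be picked far apart, with half their length as radii.
  by_cases hC : Cauchy (map u (hyperfilter ℕ : Filter ℕ))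
  · have hC' := hC.map (UniformSpace.Completion.uniformContinuous_coe M)
    obtain ⟨z, hz⟩ := CompleteSpace.complete hC'
    rw [Filter.map_map] at hz
    refine exists_isMatchingSequence_of_accumulation
      (fun w => dist (w : UniformSpace.Completion M) z) (fun a b => ?_) (fun a b => ?_)
      fun η hη => ?_
    · rw [← UniformSpace.Completion.dist_eq a b]
      have := dist_triangle (a : UniformSpace.Completion M) b z
      linarith
    · rw [← UniformSpace.Completion.dist_eq a b]
      exact dist_triangle_right _ _ _
    · have h1 : ∀ᶠ k in (hyperfilter ℕ : Filter ℕ),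
          dist (u k : UniformSpace.Completion M) z < η :=
        hz (Metric.ball_mem_nhds z hη)
      obtain ⟨k, hk, hk'⟩ := (h1.and (hlim η hη)).exists
      by_cases huz : (u k : UniformSpace.Completion M) = z
      · refine ⟨v k, ?_⟩
        rw [← huz, UniformSpace.Completion.dist_eq, dist_comm]
        exact ⟨dist_pos.2 (huv k), hk'⟩
      · exact ⟨u k, dist_pos.2 huz, hk⟩
  · rw [Metric.cauchy_iff] at hC
    push Not at hC
    obtain ⟨ε, hε, hsep⟩ := hC inferInstance
    have hfar : ∀ z : M, ∀ᶠ k in (hyperfilter ℕ : Filter ℕ), ε / 2 ≤ dist (u k) z := by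
      intro z
      by_contra hnot
      rw [← Ultrafilter.eventually_not] at hnot
      obtain ⟨a, ha, b, hb, hab⟩ := hsep (Metric.ball z (ε / 2)) (by
        change ∀ᶠ k in (hyperfilter ℕ : Filter ℕ), u k ∈ Metric.ball z (ε / 2)
        filter_upwards [hnot] with k hk
        exact not_le.1 hk)
      rw [Metric.mem_ball] at ha hb
      have := dist_triangle_right a b z
      linarith
    obtain ⟨f, hf, hff⟩ := exists_seq_of_forall_finset_exists
      (fun k => dist (u k) (v k) < ε / 8) (fun k l => ε / 2 ≤ dist (u l) (u k)) (by
        intro s _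
        have h1 : ∀ᶠ l in (hyperfilter ℕ : Filter ℕ), ∀ k ∈ s, ε / 2 ≤ dist (u l) (u k) := by
          rw [Filter.eventually_all_finset]
          exact fun k _ => hfar (u k)
        exact ((hlim (ε / 8) (by linarith)).and h1).exists)
    have key : ∀ i j, i < j →
        ε / 4 ≤ dist (u (f i)) (u (f j)) ∧ ε / 4 ≤ dist (u (f i)) (v (f j)) ∧
        ε / 4 ≤ dist (v (f i)) (u (f j)) ∧ ε / 4 ≤ dist (v (f i)) (v (f j)) := by
      intro i j hij
      have h1 := hff i j hij
      rw [dist_comm] at h1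
      have h2 := hf i
      have h3 := hf j
      have h4 := dist_triangle_right (u (f i)) (u (f j)) (v (f j))
      have h5 := dist_triangle (u (f i)) (v (f i)) (u (f j))
      have h6 := dist_triangle (u (f i)) (v (f i)) (v (f j))
      exact ⟨by linarith, by linarith, by linarith, by linarith⟩
    have hne : ∀ {a b : M}, ε / 4 ≤ dist a b → a ≠ b := fun h =>
      dist_pos.1 (lt_of_lt_of_le (by linarith) h)
    refine ⟨fun i => u (f i), fun i => v (f i),
      isMatchingSequence_of_radii (sumElim_injective_of_lt (fun i => huv _) fun i j hij => ?_)
      (fun i => dist (u (f i)) (v (f i)) / 2) (fun i => dist (u (f i)) (v (f i)) / 2)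
      (fun i => add_halves _) fun i j hij => ?_⟩
    · obtain ⟨k1, k2, k3, k4⟩ := key i j hij
      exact ⟨hne k1, hne k2, hne k3, hne k4⟩
    · obtain ⟨k1, k2, k3, k4⟩ := key i j hij
      have h2 := hf i
      have h3 := hf j
      exact ⟨by linarith, by linarith, by linarith, by linarith⟩

/-- From pairs all of whose signs are realised by Lipschitz functions one extracts a matching
sequence. -/
theorem exists_isMatchingSequence_of_signs {u v : ℕ → M} (huv : ∀ i, u i ≠ v i)
    (H : ∀ (s : Finset ℕ) (θ : ℕ → ℝ), (∀ i, |θ i| = 1) → ∃ φ : M → ℝ,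
      (∀ a b, φ a - φ b ≤ dist a b) ∧ ∀ i ∈ s, φ (u i) - φ (v i) = θ i * dist (u i) (v i)) :
    ∃ x y : ℕ → M, IsMatchingSequence x y := by
  classical
  -- When every point meets finitely many pairs, disjoint pairs can be selected greedily; otherwise
  -- the outer ends at a common point `w` form a star.
  by_cases hfin : ∀ w, {i | u i = w ∨ v i = w}.Finite
  · obtain ⟨f, -, hff⟩ := exists_seq_of_forall_finset_exists (fun _ : ℕ => True)
      (fun i j => (u i ≠ u j ∧ u i ≠ v j ∧ v i ≠ u j ∧ v i ≠ v j) ∧ i ≠ j) (by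
        intro s _
        have hfin' : (⋃ i ∈ s, ({j | u j = u i ∨ v j = u i} ∪ {j | u j = v i ∨ v j = v i})
            : Set ℕ).Finite :=
          s.finite_toSet.biUnion fun i _ => (hfin _).union (hfin _)
        obtain ⟨j, hj⟩ := hfin'.exists_notMem
        refine ⟨j, trivial, fun i hi => ?_⟩
        have hji : ¬ ((u j = u i ∨ v j = u i) ∨ (u j = v i ∨ v j = v i)) := fun h =>
          hj (Set.mem_biUnion (Finset.mem_coe.2 hi) h)
        push Not at hji
        exact ⟨⟨hji.1.1.symm, hji.1.2.symm, hji.2.1.symm, hji.2.2.symm⟩,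
          fun h => hji.1.1 (by rw [h])⟩)
    have hinj : Function.Injective f := by
      intro i j hij
      rcases lt_trichotomy i j with hlt | rfl | hlt
      exacts [absurd hij (hff i j hlt).2, rfl, absurd hij.symm (hff j i hlt).2]
    refine ⟨fun i => u (f i), fun i => v (f i), isMatchingSequence_of_signs
      (sumElim_injective_of_lt (fun i => huv _) fun i j hij => (hff i j hij).1)
      fun n θ hθ => ?_⟩
    obtain ⟨φ, hφ, hφ'⟩ := H ((Finset.range n).image f) (fun k => θ (Function.invFun f k))
      fun k => hθ _
    refine ⟨φ, hφ, fun i hi => ?_⟩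
    have := hφ' (f i) (Finset.mem_image_of_mem f (Finset.mem_range.2 hi))
    rwa [Function.leftInverse_invFun hinj i] at this
  · push Not at hfin
    obtain ⟨w, hw⟩ := hfin
    have hw' : {i | u i = w ∨ v i = w}.Infinite := hw
    let f := Nat.nth fun i => u i = w ∨ v i = w
    have hf : ∀ k, u (f k) = w ∨ v (f k) = w := fun k => Nat.nth_mem_of_infinite hw' k
    have hfinj : Function.Injective f := Nat.nth_injective hw'
    let z : ℕ → M := fun k => if u (f k) = w then v (f k) else u (f k)
    -- the sign of the edge pointing from its outer end to `w`
    let τ : ℕ → ℝ := fun i => if u i = w then -1 else 1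
    have hτ : ∀ i, |τ i| = 1 := by
      intro i
      simp only [τ]
      split_ifs <;> simp
    have hd : ∀ i j, i ≠ j → dist (z i) (z j) = dist (z i) w + dist (z j) w := by
      intro i j hij
      -- The signs make `φ` drop by the full distance from `z i` to `w` and again from `w` to `z j`,
      -- which forces equality in the triangle inequality.
      obtain ⟨φ, hφ, hφ'⟩ := H {f i, f j} (fun k => if k = f i then τ k else - τ k) (by
        intro k
        split_ifs
        · exact hτ k
        · rw [abs_neg, hτ])
      have hz : ∀ k, φ (z k) - φ w = τ (f k) * (φ (u (f k)) - φ (v (f k))) ∧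
          dist (z k) w = dist (u (f k)) (v (f k)) ∧ τ (f k) * τ (f k) = 1 := by
        intro k
        simp only [z, τ]
        by_cases hk : u (f k) = w
        · simp only [hk, if_true]
          exact ⟨by ring, dist_comm _ _, by norm_num⟩
        · have hk' := (hf k).resolve_left hk
          simp only [hk, if_false, hk']
          exact ⟨by ring, trivial, by norm_num⟩
      have h1 := hφ' (f i) (by simp)
      have h2 := hφ' (f j) (by simp)
      rw [if_pos rfl] at h1
      rw [if_neg (hfinj.ne hij.symm)] at h2
      obtain ⟨a1, a2, a3⟩ := hz i
      obtain ⟨b1, b2, b3⟩ := hz j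
      rw [h1, ← a2, ← mul_assoc, a3, one_mul] at a1
      rw [h2, ← b2, ← mul_assoc, mul_neg, b3] at b1
      refine le_antisymm (dist_triangle_right _ _ _) ?_
      have := hφ (z i) (z j)
      linarith
    have hz0 : ∀ k, 0 < dist (z k) w := by
      intro k
      rw [dist_pos]
      simp only [z]
      split_ifs with hk
      · exact fun h => huv (f k) (hk.trans h.symm)
      · exact hk
    refine exists_isMatchingSequence_of_star (z := z) (fun i j hij => ?_) _ hd
    by_contra hne
    have h1 := hd i j hne
    rw [hij, dist_self] at h1
    linarith [hz0 j]

end Geometry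

/-! ### Saturated pairs in uniformly discrete spaces. -/

section UniformlyDiscrete

open Filter Topology

variable {M : Type*}

theorem pairing_eq_of_eqOn {φ ψ : M → ℝ} {g : TP M}
    (h : ∀ x ∈ (TP.toFinsupp M g).support, φ x = ψ x) : pairing φ g = pairing ψ g := by
  rw [pairing_apply, pairing_apply]
  exact Finset.sum_congr rfl fun x hx => by rw [h x hx]

/-- The total mass of the positive part of a transportation problem. -/
def posMass (g : TP M) : ℝ :=
  ∑ x ∈ (TP.toFinsupp M g).support with 0 < TP.toFinsupp M g x, TP.toFinsupp M g x

theorem pairing_le_mul_posMass {φ : M → ℝ} {R : ℝ} (h0 : ∀ x, 0 ≤ φ x) (hR : ∀ x, φ x ≤ R)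
    (g : TP M) : pairing φ g ≤ R * posMass g := by
  rw [pairing_apply, posMass, Finset.sum_filter, Finset.mul_sum]
  refine Finset.sum_le_sum fun x _ => ?_
  split_ifs with hx
  · rw [mul_comm]
    exact mul_le_mul_of_nonneg_right (hR x) hx.le
  · rw [mul_zero]
    exact mul_nonpos_of_nonpos_of_nonneg (not_lt.1 hx) (h0 x)

theorem pairing_eq_mul_posMass {φ : M → ℝ} {t : ℝ} {g : TP M}
    (hpos : ∀ x, 0 < TP.toFinsupp M g x → φ x = t) (hneg : ∀ x, TP.toFinsupp M g x < 0 → φ x = 0) :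
    pairing φ g = t * posMass g := by
  rw [pairing_apply, posMass, Finset.sum_filter, Finset.mul_sum]
  refine Finset.sum_congr rfl fun x hx => ?_
  split_ifs with h
  · rw [hpos x h, mul_comm]
  · rw [hneg x (lt_of_le_of_ne (not_lt.1 h) (Finsupp.mem_support_iff.1 hx)), mul_zero, mul_zero]

variable [MetricSpace M]

theorem abs_apply_le {Λ : TC M →L[ℝ] ℝ} {K : ℝ} (hΛ : ‖Λ‖ ≤ K) (f : TC M) : |Λ f| ≤ K * ‖f‖ :=
  (Λ.le_opNorm f).trans (by gcongr)

theorem exists_dist_lt (f : TC M) {ε : ℝ} (hε : 0 < ε) : ∃ g : TP M, ‖f - g‖ < ε := by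
  obtain ⟨g, hg⟩ := (UniformSpace.Completion.denseRange_coe (α := TP M)).exists_dist_lt f hε
  exact ⟨g, by rwa [← dist_eq_norm]⟩

/-- A nonzero element is seen by a bounded Lipschitz function. -/
theorem exists_bounded_lipschitz [Nonempty M] {f : TC M} (hf : f ≠ 0) :
    ∃ (β : M → ℝ) (R : ℝ) (Λ : TC M →L[ℝ] ℝ), 0 < R ∧ (∀ x, 0 ≤ β x) ∧ (∀ x, β x ≤ R) ∧
      ‖Λ‖ ≤ 1 ∧ (∀ g : TP M, Λ g = pairing β g) ∧ 0 < Λ f := by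
  have hf' : 0 < ‖f‖ := norm_pos_iff.2 hf
  obtain ⟨Λ, hΛ, hΛf⟩ := exists_dual_vector'' ℝ f
  obtain ⟨φ, hφ, hrep⟩ := exists_lipschitz_of_functional Λ hΛ
  obtain ⟨g, hg⟩ := exists_dist_lt f (show 0 < ‖f‖ / 4 by linarith)
  set S := (TP.toFinsupp M g).support
  set R : ℝ := 1 + ∑ x ∈ S, |φ x| with hR
  have hR0 : 0 < R := by positivity
  have hφR : ∀ x ∈ S, |φ x| ≤ R := fun x hx => by
    have := Finset.single_le_sum (f := fun x => |φ x|) (fun _ _ => abs_nonneg _) hx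
    linarith
  -- On the support of `g` nothing is clipped and the shift by `R` pairs to zero, so `β` and `φ`
  -- agree on `g`; the error `‖f‖ / 4` on each side leaves at least `‖f‖ / 2`.
  let β : M → ℝ := fun x => max 0 (min (φ x + R) (2 * R))
  have hβ : ∀ x y, β x - β y ≤ 1 * dist x y := by
    intro x y
    have h1 := hφ x y
    have h2 : (0 : ℝ) ≤ dist x y := dist_nonneg
    have h3 : β x ≤ β y + dist x y := by
      refine max_le (add_nonneg (le_max_left _ _) h2) ?_
      have h4 : min (φ y + R) (2 * R) ≤ β y := le_max_right _ _
      rcases min_choice (φ y + R) (2 * R) with h5 | h5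
      · linarith [min_le_left (φ x + R) (2 * R)]
      · linarith [min_le_right (φ x + R) (2 * R)]
    linarith
  obtain ⟨Λ', hΛ', hrep'⟩ := exists_functional zero_le_one hβ
  refine ⟨β, 2 * R, Λ', by linarith, fun x => le_max_left _ _,
    fun x => max_le (by linarith) (min_le_right _ _), hΛ', hrep', ?_⟩
  have h1 : Λ' g = Λ g := by
    have h2 : pairing β g = pairing (fun x => φ x + R) g := by
      refine pairing_eq_of_eqOn fun x hx => ?_
      have h3 := abs_le.1 (hφR x hx)
      simp only [β]
      rw [min_eq_left (by linarith), max_eq_right (by linarith)]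
    rw [hrep, hrep', h2, pairing_add_left, pairing_const, add_zero]
  have h2 := (abs_le.1 (abs_apply_le hΛ' (f - g))).1
  have h3 := (abs_le.1 (abs_apply_le hΛ (f - g))).2
  have hΛf' : Λ f = ‖f‖ := hΛf
  rw [map_sub] at h2 h3
  linarith

/-- A function with values in `[0, R]` that sees `f` keeps the positive mass of good approximants
away from zero, while the error tends to zero. -/
theorem exists_small_dist_large_posMass [Nonempty M] {f : TC M} (hf : f ≠ 0) {δ : ℝ} (hδ : 0 < δ) :
    ∃ g : TP M, ‖f - g‖ < δ * posMass g := by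
  obtain ⟨β, R, Λ, hR, h0, hβR, hΛ, hrep, hpos⟩ := exists_bounded_lipschitz hf
  obtain ⟨g, hg⟩ := exists_dist_lt f (show 0 < δ * Λ f / (δ + R) by positivity)
  refine ⟨g, ?_⟩
  have h1 := (abs_le.1 (abs_apply_le hΛ (f - g))).2
  rw [map_sub, hrep] at h1
  have h2 := pairing_le_mul_posMass h0 hβR g
  rw [lt_div_iff₀ (by positivity)] at hg
  have h3 : δ * Λ f ≤ δ * ‖f - g‖ + δ * (R * posMass g) := by nlinarith
  have h4 : R * ‖f - g‖ < R * (δ * posMass g) := by nlinarith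
  exact lt_of_mul_lt_mul_left h4 hR.le

/-- Norming functionals form a convex set, and strictness at a pair survives averaging. -/
theorem exists_norming_of_finset {f : TC M} {s : Finset (M × M)}
    (h : ∀ p ∈ s, ∃ Λ : TC M →L[ℝ] ℝ, ‖Λ‖ ≤ 1 ∧ Λ f = ‖f‖ ∧ Λ (dipole p.1 p.2) ≠ dist p.1 p.2) :
    ∃ Λ : TC M →L[ℝ] ℝ, ‖Λ‖ ≤ 1 ∧ Λ f = ‖f‖ ∧
      ∀ p ∈ s, Λ (dipole p.1 p.2) < dist p.1 p.2 := by
  classical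
  have hle : ∀ (Λ : TC M →L[ℝ] ℝ), ‖Λ‖ ≤ 1 → ∀ x y : M, Λ (dipole x y : TP M) ≤ dist x y := by
    intro Λ hΛ x y
    have h1 := (abs_le.1 (abs_apply_le hΛ (dipole x y : TP M))).2
    rw [one_mul, UniformSpace.Completion.norm_coe] at h1
    exact h1.trans (norm_dipole_le x y)
  induction s using Finset.induction_on with
  | empty =>
    obtain ⟨Λ, hΛ, hΛf⟩ := exists_dual_vector'' ℝ f
    exact ⟨Λ, hΛ, hΛf, by simp⟩
  | insert p s _ ih =>
    obtain ⟨Λ, hΛ, hΛf, hΛs⟩ := ih fun q hq => h q (Finset.mem_insert_of_mem hq)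
    obtain ⟨Λ', hΛ', hΛf', hne⟩ := h p (Finset.mem_insert_self _ _)
    have hlt := lt_of_le_of_ne (hle Λ' hΛ' p.1 p.2) hne
    have hval : ∀ e : TC M, ((1 / 2 : ℝ) • (Λ + Λ')) e = (Λ e + Λ' e) / 2 := by
      intro e
      rw [smul_apply, add_apply, smul_eq_mul]
      ring
    refine ⟨(1 / 2 : ℝ) • (Λ + Λ'), ?_, ?_, fun q hq => ?_⟩
    · rw [norm_smul, Real.norm_of_nonneg (by norm_num)]
      linarith [norm_add_le Λ Λ']
    · rw [hval, hΛf, hΛf']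
      ring
    · rw [hval]
      rcases Finset.mem_insert.1 hq with rfl | hq
      · linarith [hle Λ hΛ q.1 q.2]
      · linarith [hle Λ' hΛ' q.1 q.2, hΛs q hq]

/-- In a uniformly discrete space, every nonzero element has a pair of points that is saturated by
all its norming functionals. -/
theorem exists_saturated_pair {δ : ℝ} (hδ : 0 < δ) (hM : ∀ u v : M, u ≠ v → δ ≤ dist u v)
    [Nonempty M] {f : TC M} (hf : f ≠ 0) :
    ∃ u v : M, u ≠ v ∧ ∀ Λ : TC M →L[ℝ] ℝ, ‖Λ‖ ≤ 1 → Λ f = ‖f‖ → Λ (dipole u v) = dist u v := by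
  classical
  -- Otherwise some norming `φ` has slack on all pairs from the positive to the negative part of
  -- `g`. Raising it by a small `t` on the positive part gains `t * posMass g` on `g`, while passing
  -- from `g` to `f` loses less; the value at `f` then exceeds `‖f‖`.
  by_contra hcon
  push Not at hcon
  obtain ⟨g, hg⟩ := exists_small_dist_large_posMass hf hδ
  set G := TP.toFinsupp M g with hG
  let P := G.support.filter fun x => 0 < G x
  let N := G.support.filter fun x => G x < 0
  have hP : ∀ x, x ∈ P ↔ 0 < G x := fun x => by
    simp only [P, Finset.mem_filter, Finsupp.mem_support_iff]
    exact ⟨fun h => h.2, fun h => ⟨h.ne', h⟩⟩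
  have hN : ∀ x, x ∈ N ↔ G x < 0 := fun x => by
    simp only [N, Finset.mem_filter, Finsupp.mem_support_iff]
    exact ⟨fun h => h.2, fun h => ⟨h.ne, h⟩⟩
  have hmass : 0 < posMass g := by
    have := (norm_nonneg _).trans_lt hg
    exact pos_of_mul_pos_right this hδ.le
  have hPne : P.Nonempty := by
    rw [Finset.nonempty_iff_ne_empty]
    intro hempty
    have : posMass g = ∑ x ∈ P, G x := rfl
    rw [this, hempty, Finset.sum_empty] at hmass
    exact lt_irrefl _ hmass
  obtain ⟨Λ, hΛ, hΛf, hslack⟩ := exists_norming_of_finset (f := f) (s := P ×ˢ N) (by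
    intro p hp
    obtain ⟨h1, h2⟩ := Finset.mem_product.1 hp
    refine hcon p.1 p.2 fun h => ?_
    rw [h, hP] at h1
    rw [hN] at h2
    exact lt_asymm h1 h2)
  obtain ⟨φ, hφ, hrep⟩ := exists_lipschitz_of_functional Λ hΛ
  obtain ⟨t, ht, hts⟩ : ∃ t > 0, ∀ p ∈ P ×ˢ N, t ≤ dist p.1 p.2 - (φ p.1 - φ p.2) := by
    have : ∀ᶠ t in 𝓝[>] (0 : ℝ), ∀ p ∈ P ×ˢ N, t ≤ dist p.1 p.2 - (φ p.1 - φ p.2) := by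
      rw [Filter.eventually_all_finset]
      intro p hp
      refine nhdsWithin_le_nhds (eventually_le_nhds ?_)
      rw [← pairing_dipole, ← hrep]
      exact sub_pos.2 (hslack p hp)
    exact (this.and self_mem_nhdsWithin).exists.imp fun η h => ⟨h.2, h.1⟩
  -- raise `φ` by `t` on `P`
  let m : M → ℝ := fun z => P.sup' hPne fun u => φ u - dist u z
  let ψ : M → ℝ := fun z => max (φ z) (t + m z)
  have hmφ : ∀ z, m z ≤ φ z := fun z => Finset.sup'_le _ _ fun u _ => by linarith [hφ u z]
  have hmlip : ∀ x y, m x ≤ m y + dist x y := by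
    intro x y
    refine Finset.sup'_le _ _ fun u hu => ?_
    have h1 : φ u - dist u y ≤ m y := Finset.le_sup' (fun u => φ u - dist u y) hu
    have h2 := dist_triangle u x y
    linarith
  have hψ : ∀ x y, ψ x - ψ y ≤ 1 * dist x y := by
    intro x y
    have h1 : ψ x ≤ ψ y + dist x y := by
      refine max_le ?_ ?_
      · linarith [hφ x y, le_max_left (φ y) (t + m y)]
      · linarith [hmlip x y, le_max_right (φ y) (t + m y)]
    linarith
  have hψ0 : ∀ z, φ z ≤ ψ z := fun z => le_max_left _ _
  have hψt : ∀ z, ψ z ≤ φ z + t := fun z => max_le (by linarith) (by linarith [hmφ z])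
  -- Uniform discreteness enters here: a function with values in `[0, t]` is `t / δ`-Lipschitz.
  have hlip : ∀ x y, (ψ x - φ x) - (ψ y - φ y) ≤ t / δ * dist x y := by
    intro x y
    rcases eq_or_ne x y with rfl | hxy
    · simp
    · have h1 : t ≤ t / δ * dist x y := by
        rw [div_mul_eq_mul_div, le_div_iff₀ hδ]
        exact mul_le_mul_of_nonneg_left (hM x y hxy) ht.le
      linarith [hψt x, hψ0 y]
  obtain ⟨Λψ, hΛψ, hrepψ⟩ := exists_functional zero_le_one hψ
  obtain ⟨Λh, hΛh, hreph⟩ := exists_functional (by positivity) hlip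
  have hval : pairing (fun x => ψ x - φ x) g = t * posMass g := by
    refine pairing_eq_mul_posMass (fun x hx => ?_) fun x hx => ?_
    · have h1 : φ x - dist x x ≤ m x :=
        Finset.le_sup' (fun u => φ u - dist u x) ((hP x).2 hx)
      rw [dist_self] at h1
      have h2 := le_max_right (φ x) (t + m x)
      linarith [hψt x]
    -- The slack `t` is what keeps the raised function from exceeding `φ` on the negative part.
    · have h1 : t + m x ≤ φ x := by
        rw [← le_sub_iff_add_le']
        refine Finset.sup'_le _ _ fun u hu => ?_
        have := hts (u, x) (Finset.mk_mem_product hu ((hN x).2 hx))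
        simp only at this
        linarith
      simp only [ψ]
      rw [max_eq_left h1, sub_self]
  have hsum : Λψ = Λ + Λh := by
    refine ContinuousLinearMap.ext fun e => ?_
    refine congrFun (UniformSpace.Completion.ext (f := Λψ) (g := fun e => Λ e + Λh e)
      Λψ.continuous (Λ.continuous.add Λh.continuous) fun a => ?_) e
    rw [hrepψ, hrep, hreph, ← pairing_add_left]
    simp
  have h1 := (abs_le.1 (abs_apply_le hΛψ f)).2
  rw [hsum, add_apply, hΛf] at h1
  have h2 := (abs_le.1 (abs_apply_le hΛh (f - g))).1
  rw [map_sub, hreph, hval] at h2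
  have h3 : t / δ * ‖f - g‖ < t / δ * (δ * posMass g) :=
    mul_lt_mul_of_pos_left hg (by positivity)
  have h4 : t / δ * (δ * posMass g) = t * posMass g := by field_simp
  linarith

theorem exists_isMatchingSequence_of_linearIsometry [Nonempty M]
    (T : lp (fun _ : ℕ => ℝ) 1 →ₗᵢ[ℝ] TC M) : ∃ x y : ℕ → M, IsMatchingSequence x y := by
  classical
  by_cases hd : ∀ δ > 0, ∃ u v : M, u ≠ v ∧ dist u v < δ
  · exact exists_isMatchingSequence_of_not_uniformly_discrete hd
  push Not at hd
  obtain ⟨δ, hδ, hM⟩ := hd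
  let f : ℕ → TC M := fun i => T (lp.single 1 i 1)
  have hsum : ∀ (s : Finset ℕ) (θ : ℕ → ℝ), ‖∑ i ∈ s, θ i • f i‖ = ∑ i ∈ s, |θ i| := by
    intro s θ
    have h1 : ∑ i ∈ s, θ i • f i = T (∑ i ∈ s, lp.single 1 i (θ i)) := by
      rw [map_sum]
      refine Finset.sum_congr rfl fun i _ => ?_
      rw [← map_smul, ← lp.single_smul, smul_eq_mul, mul_one]
    rw [h1, T.norm_map]
    simpa using lp.norm_sum_single (E := fun _ : ℕ => ℝ) (p := 1) (by simp) θ s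
  have hf1 : ∀ i, ‖f i‖ = 1 := fun i => by simpa using hsum {i} 1
  have hf0 : ∀ i, f i ≠ 0 := fun i => norm_ne_zero_iff.1 (by rw [hf1]; exact one_ne_zero)
  choose u v huv hsat using fun i => exists_saturated_pair hδ hM (hf0 i)
  refine exists_isMatchingSequence_of_signs huv fun s θ hθ => ?_
  obtain ⟨Λ, hΛ, hΛf⟩ := exists_dual_vector'' ℝ (∑ i ∈ s, θ i • f i)
  have hΛf' : ∑ i ∈ s, θ i * Λ (f i) = ∑ i ∈ s, (1 : ℝ) := by
    have h1 : Λ (∑ i ∈ s, θ i • f i) = ‖∑ i ∈ s, θ i • f i‖ := hΛf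
    rw [hsum, map_sum] at h1
    simpa [hθ] using h1
  have hle : ∀ i ∈ s, θ i * Λ (f i) ≤ 1 := fun i _ => by
    have := abs_apply_le hΛ (f i)
    rw [hf1, one_mul] at this
    calc θ i * Λ (f i) ≤ |θ i * Λ (f i)| := le_abs_self _
      _ = |Λ (f i)| := by rw [abs_mul, hθ, one_mul]
      _ ≤ 1 := this
  -- Terms bounded by 1 whose sum is their number all equal 1, so `θ i • Λ` norms `f i` and
  -- saturates its pair.
  have heq := (Finset.sum_eq_sum_iff_of_le hle).1 hΛf'
  obtain ⟨φ, hφ, hrep⟩ := exists_lipschitz_of_functional Λ hΛ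
  refine ⟨φ, hφ, fun i hi => ?_⟩
  have h1 := hsat i (θ i • Λ) (by rw [norm_smul, Real.norm_eq_abs, hθ, one_mul]; exact hΛ) (by
    rw [hf1, smul_apply, smul_eq_mul]
    exact heq i hi)
  rw [smul_apply, smul_eq_mul, hrep, pairing_dipole] at h1
  have h2 : θ i * θ i = 1 := by rw [← abs_mul_abs_self, hθ, one_mul]
  rw [← h1, ← mul_assoc, h2, one_mul]

end UniformlyDiscrete

end TransportationCost

end

theorem theorem1 (M : Type*) [MetricSpace M] [Infinite M] :
    Nonempty (lp (fun _ : ℕ => ℝ) 1 →ₗᵢ[ℝ] TransportationCost.TC M) ↔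
      ∃ x y : ℕ → M, Function.Injective (Sum.elim x y) ∧
        ∀ n : ℕ, TransportationCost.IsMinWeightPerfectMatching
          (TransportationCost.points x y n) (TransportationCost.edges x y n) :=
  ⟨fun ⟨T⟩ => TransportationCost.exists_isMatchingSequence_of_linearIsometry T,
    fun ⟨_, _, h⟩ => TransportationCost.IsMatchingSequence.nonempty_linearIsometry h⟩
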